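/- Let $\mathbb T=\mathbb R/\mathbb Z$, $d\ge 1$, and let $\mathop{\rm mes}$ be normalized Lebesgue measure on $\mathbb T^d$. Write $e(x)=(e^{2\pi i x_1},\dots,e^{2\pi i x_d})$ and $\mathcal A_\rho=\{z\in\mathbb C: 1-\rho<|z|<1+\rho\}$. Let $T:\mathbb T^d\to\mathbb T^d$ be measure preserving and $V:\mathbb T^d\to\mathbb R$, and assume: (i) there are constants $A,C_1>0$ such that for every disk $D\subset\mathbb T^d$ $$\sup_{x\in\mathbb T^d}\min\{n\ge1: T^{2n+1}x\in D\}\le C_1(\mathop{\rm diam}D)^{-A};$$ (ii) $V$ is analytic, and the functions $V\circ T^n$, $n\ge 0$, extend analytically to a common neighborhood of the torus with a common bound: there are $\rho>0$ and $K$ such that for every $n\ge0$ there is a holomorphic $F_n:\mathcal A_\rho^d\to\mathbb C$ with $|F_n|\le K$ and $F_n(e(x))=V(T^nx)$ for all $x\in\mathbb T^d$ (for shifts $Tx=x+\omega$ this is just analyticity of $V$). For $E\in\mathbb R$ and $n\ge1$ put $$M_n(x,E)=\prod_{j=n}^{1}\begin{bmatrix}V(T^jx)-E&-1\\1&0\end{bmatrix},\qquad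 L_n(E)=\frac1n\int_{\mathbb T^d}\log\|M_n(x,E)\|\,dx,\qquad L(E)=\lim_{n\to\infty}L_n(E)=\inf_{n\ge1}L_n(E),$$ where $\|\cdot\|$ is the operator norm on Euclidean $\mathbb R^2$, and let $H_{[1,N]}(x)$ be the $N\times N$ tridiagonal matrix with diagonal entries $V(Tx),\dots,V(T^Nx)$ and with $-1$ above and below the diagonal. For all $0<\sigma<1$ and $\kappa>0$ there is $\tau=\tau(d,\sigma,\kappa)>0$ such that for all $T,V$ as above and all $\gamma,C>0$ there is $N_0$, depending only on $d,\sigma,\kappa,T,V,\gamma,C$, with the following property. Let $N\ge N_0$ be an integer and let $E\in\mathbb R$ satisfy $L(E)>\gamma$. Assume that, for these $N$ and $E$, $$\mathop{\rm mes}\Bigl[x\in\mathbb T^d:\bigl|\log\|M_N(x,E)\|-N L_N(E)\bigr|>N^{1-\sigma}\Bigr]\le C\exp(-N^\sigma)$$ and $$\sup_{x\in\mathbb T^d}\frac1N\log\|M_N(x,E)\|<L_N(E)+N^{-\kappa}.$$ Then, with the convention $\log 0=-\infty$, $$\mathop{\rm mes}\Bigl[x\in\mathbb T^d:\frac1N\log\bigl|\det(H_{[1,N]}(x)-E)\bigr|<L_N(E)-N^{-\tau}\Bigr]\le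 e^{-N^\tau}.$$ -/

import Mathlib

open MeasureTheory

noncomputable section

namespace DetLDT

/-- The torus `𝕋^d = (ℝ/ℤ)^d`; `volume` is its normalized Haar measure. -/
abbrev Torus (d : ℕ) : Type := Fin d → UnitAddCircle

/-- The point `(e(x₁), …, e(x_d)) ∈ ℂ^d`, where `e(t) = exp(2πit)`. -/
def e {d : ℕ} (x : Torus d) : Fin d → ℂ := fun i => ((x i).toCircle : ℂ)

/-- The product of `d` copies of the annulus `{z ∈ ℂ : 1 - ρ < |z| < 1 + ρ}`. -/
def annuli (d : ℕ) (ρ : ℝ) : Set (Fin d → ℂ) :=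
  {z | ∀ i, 1 - ρ < ‖z i‖ ∧ ‖z i‖ < 1 + ρ}

/-- `V` is real-analytic, and all the potentials `x ↦ V (T^n x)` extend, as functions of `e(x)`,
to holomorphic functions on one and the same product of annuli, with one common bound.
The case `n = 0` says that `V` itself is analytic. For a shift `T` this is just analyticity of
`V`. -/
def UniformlyAnalytic {d : ℕ} (T : Torus d → Torus d) (V : Torus d → ℝ) : Prop :=
  ∃ ρ > 0, ∃ K : ℝ, ∀ n : ℕ, ∃ F : (Fin d → ℂ) → ℂ,
    AnalyticOnNhd ℂ F (annuli d ρ) ∧ (∀ z ∈ annuli d ρ, ‖F z‖ ≤ K) ∧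
      ∀ x : Torus d, F (e x) = (V (T^[n] x) : ℂ)

/-- Polynomial return times: for some constants `A`, `C`, from every starting point every disk
`D` is visited at a time `2n+1`, `n ≥ 1`, with `n ≤ C (diam D)^{-A}`. -/
def PolynomialReturn {d : ℕ} (T : Torus d → Torus d) : Prop :=
  ∃ A > (0 : ℝ), ∃ C > (0 : ℝ), ∀ (y : Torus d) (r : ℝ), 0 < r → ∀ x : Torus d,
    ∃ n : ℕ, 1 ≤ n ∧ T^[2 * n + 1] x ∈ Metric.ball y r ∧
      (n : ℝ) ≤ C * Metric.diam (Metric.ball y r) ^ (-A)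

section Schrodinger

variable {d : ℕ} (T : Torus d → Torus d) (V : Torus d → ℝ) (E : ℝ)

/-- The one-step matrix `A(x,E)`. -/
def stepMatrix (x : Torus d) : Matrix (Fin 2) (Fin 2) ℝ :=
  !![V x - E, -1; 1, 0]

/-- The monodromy matrix `M_n(x,E) = A(T^n x,E) ⋯ A(T x,E)`. -/
def monodromy : ℕ → Torus d → Matrix (Fin 2) (Fin 2) ℝ
  | 0, _ => 1
  | n + 1, x => stepMatrix V E (T^[n + 1] x) * monodromy n x

/-- `log ‖M_n(x,E)‖`, with the operator norm on Euclidean `ℝ²`. -/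
def logNorm (n : ℕ) (x : Torus d) : ℝ :=
  Real.log ‖Matrix.toEuclideanCLM (n := Fin 2) (𝕜 := ℝ) (monodromy T V E n x)‖

/-- `L_n(E) = (1/n) ∫ log ‖M_n(x,E)‖ dx`. -/
def finiteLyapunov (n : ℕ) : ℝ := (1 / (n : ℝ)) * ∫ x : Torus d, logNorm T V E n x

/-- The Lyapunov exponent `L(E) = inf_{n ≥ 1} L_n(E)` (which equals `lim L_n(E)`, by
subadditivity). -/
def lyapunov : ℝ := ⨅ n : ℕ, finiteLyapunov T V E (n + 1)

/-- The Schrödinger operator on `[1,N]` with zero boundary conditions: diagonal entries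
`V(T x), …, V(T^N x)` and `-1` next to the diagonal. -/
def hamiltonian (N : ℕ) (x : Torus d) : Matrix (Fin N) (Fin N) ℝ :=
  Matrix.of fun i j =>
    if i = j then V (T^[(i : ℕ) + 1] x)
    else if (i : ℕ) + 1 = j ∨ (j : ℕ) + 1 = i then -1 else 0

/-- `f_N(x,E) = det (H_{[1,N]}(x) - E)`. -/
def dirichletDet (N : ℕ) (x : Torus d) : ℝ :=
  (hamiltonian T V N x - E • (1 : Matrix (Fin N) (Fin N) ℝ)).det

end Schrodinger

end DetLDT

end

open MeasureTheory

namespace DetLDT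

/-! ### Determinants as entries of the monodromy matrix -/

section Algebra

variable {d : ℕ} (T : Torus d → Torus d) (V : Torus d → ℝ) (E : ℝ)

/-! Write `f_n` for the Dirichlet determinant of order `n`. It is the `(0,0)` entry of `M_n`, and
the other entries of `M_n` are, up to sign and shift, determinants of order `n - 1` and `n - 2`.
Suppose that `f_N` is below `exp (N L_N - N^(1-τ))` on a set of measure more than `exp (-N^τ)`;
smallness is then pushed to a much shorter scale, where it contradicts `L(E) > γ`.

Spreading: `f_N` is holomorphic along complexified lines, and its real upper bound, interpolated
with the trivial bound, controls it on strips of width `N^(-θ)`. A Remez inequality (`strip_remez`)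
then makes `f_N` small on a whole ball of radius about `N^(-θ)` (`eventually_small_on_ball`).

Descent: since `det M_N = 1`, a small `(0,0)` entry forces the first column or the first row of
`M_N` to be small, while the large deviation estimate keeps `‖M_N‖` large at most points. Recurrence
gives a time `n + 1` of order at most `N^(1/10)` at which many such points return to such points.
Comparing entries in `M_N(T^(n+1) x) M_(n+1)(x) = M_(n+1)(T^N x) M_N(x)` makes the short determinant
`f_n` tiny at `x` or at `T^(N+1) x` (`eventually_exists_small_det`). A second use of Remez, on
segments long enough to start at any point of the torus, makes `f_n` tiny everywhere
(`eventually_flat_of_small`).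

Contradiction: if `f_(p+1)` is tiny everywhere, `det M_(p+1) = 1` reads `f_p(x) f_p(Tx) ≈ 1`, so
`f_p` is almost invariant under `T^2`. Odd return times give `f_p(x) ≈ f_p(Tx)`, hence `|f_p| ≈ 1`,
so `M_(p+2)` has norm close to one and `L_(p+2) ≤ γ` (`eventually_not_flat`). Parity is essential:
`f_p` could otherwise alternate between a large value and its inverse.

Energies far from the range of `V` are treated directly: there `‖M_N‖ ≤ 2 |f_N|`. -/

lemma monodromy_add (m n : ℕ) (x : Torus d) :
    monodromy T V E (m + n) x = monodromy T V E m (T^[n] x) * monodromy T V E n x := by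
  induction m with
  | zero => simp [monodromy]
  | succ m ih =>
    rw [show m + 1 + n = (m + n) + 1 by ring]
    simp only [monodromy]
    rw [ih, Matrix.mul_assoc, ← Function.iterate_add_apply]
    rw [show m + n + 1 = m + 1 + n by ring]

lemma monodromy_succ_apply_one (n : ℕ) (x : Torus d) (j : Fin 2) :
    monodromy T V E (n + 1) x 1 j = monodromy T V E n x 0 j := by
  simp [monodromy, stepMatrix, Matrix.mul_apply, Fin.sum_univ_two]

lemma monodromy_succ_apply_zero (n : ℕ) (x : Torus d) (j : Fin 2) :
    monodromy T V E (n + 1) x 0 j =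
      (V (T^[n + 1] x) - E) * monodromy T V E n x 0 j - monodromy T V E n x 1 j := by
  simp [monodromy, stepMatrix, Matrix.mul_apply, Fin.sum_univ_two]
  ring

lemma monodromy_apply_right_one (n : ℕ) (x : Torus d) (i : Fin 2) :
    monodromy T V E (n + 1) x i 1 = -monodromy T V E n (T x) i 0 := by
  rw [monodromy_add T V E n 1 x]
  simp [monodromy, stepMatrix, Matrix.mul_apply, Fin.sum_univ_two]

lemma monodromy_apply_right_zero (n : ℕ) (x : Torus d) (i : Fin 2) :
    monodromy T V E (n + 1) x i 0 =
      (V (T x) - E) * monodromy T V E n (T x) i 0 + monodromy T V E n (T x) i 1 := by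
  rw [monodromy_add T V E n 1 x]
  simp [monodromy, stepMatrix, Matrix.mul_apply, Fin.sum_univ_two]
  ring

lemma det_monodromy (n : ℕ) (x : Torus d) : (monodromy T V E n x).det = 1 := by
  induction n with
  | zero => simp [monodromy]
  | succ n ih =>
    rw [monodromy, Matrix.det_mul, ih, stepMatrix, Matrix.det_fin_two_of]
    ring

/-- This is `det M_(n+1) = 1` with both off-diagonal entries expressed through order `n`. When
`f_(n+1)` is tiny it says that `f_n(x) f_n(Tx)` is nearly one. -/
lemma monodromy_det_identity (n : ℕ) (x : Torus d) :
    monodromy T V E (n + 1) x 0 0 * monodromy T V E (n + 1) x 1 1 +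
      monodromy T V E n x 0 0 * monodromy T V E n (T x) 0 0 = 1 := by
  have h := det_monodromy T V E (n + 1) x
  rw [Matrix.det_fin_two, monodromy_apply_right_one T V E n x 0,
    monodromy_succ_apply_one T V E n x 0] at h
  linarith

/-- Laplace expansion along the last row leaves two minors; the off-diagonal one is expanded once
more along its last column. -/
lemma dirichletDet_add_two (n : ℕ) (x : Torus d) :
    dirichletDet T V E (n + 2) x =
      (V (T^[n + 2] x) - E) * dirichletDet T V E (n + 1) x - dirichletDet T V E n x := by
  unfold dirichletDet
  rw [Matrix.det_succ_row _ (Fin.last (n + 1)), Fin.sum_univ_castSucc]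
  rw [Finset.sum_eq_single (Fin.last n)]
  · have h1 : ((hamiltonian T V (n + 2) x - E • 1).submatrix (Fin.last (n + 1)).succAbove
        (Fin.last (n + 1)).succAbove) = hamiltonian T V (n + 1) x - E • 1 := by
      ext i j
      simp [hamiltonian, Matrix.one_apply]
    have h2 : ((hamiltonian T V (n + 2) x - E • 1).submatrix (Fin.last (n + 1)).succAbove
        (Fin.last n).castSucc.succAbove).det = -(hamiltonian T V n x - E • 1).det := by
      rw [Matrix.det_succ_column _ (Fin.last n), Finset.sum_eq_single (Fin.last n)]
      · have h3 : (((hamiltonian T V (n + 2) x - E • 1).submatrix (Fin.last (n + 1)).succAbove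
            (Fin.last n).castSucc.succAbove).submatrix (Fin.last n).succAbove
            (Fin.last n).succAbove) = hamiltonian T V n x - E • 1 := by
          ext i j
          have hj : (Fin.last n).castSucc.succAbove j.castSucc = j.castSucc.castSucc := by
            apply Fin.succAbove_of_castSucc_lt
            simp [Fin.lt_def]
          simp [hamiltonian, Matrix.one_apply, hj]
        rw [h3]
        have hl : (Fin.last n).castSucc.succAbove (Fin.last n) = Fin.last (n + 1) := by
          rw [Fin.succAbove_of_le_castSucc] <;> simp
        simp [hamiltonian, hl, Fin.ext_iff, ← two_mul]
      · intro i _ hi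
        have hl : (Fin.last n).castSucc.succAbove (Fin.last n) = Fin.last (n + 1) := by
          rw [Fin.succAbove_of_le_castSucc] <;> simp
        have : (i : ℕ) < n := by
          have := i.2
          have : (i : ℕ) ≠ n := fun h => hi (Fin.ext h)
          omega
        have : ((hamiltonian T V (n + 2) x - E • 1).submatrix (Fin.last (n + 1)).succAbove
            (Fin.last n).castSucc.succAbove) i (Fin.last n) = 0 := by
          have e1 : ¬ ((i : ℕ) = n + 1) := by omega
          have e3 : ¬ (n + 1 + 1 = (i : ℕ)) := by omega
          have e4 : ¬ ((i : ℕ) = n) := by omega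
          simp [hamiltonian, hl, Fin.ext_iff, e1, e3, e4]
        rw [this]; simp
      · simp
    rw [h1, h2]
    have hs : (-1 : ℝ) ^ (n + 1 + n) = -1 := by
      rw [show n + 1 + n = 2 * n + 1 by ring, pow_add, pow_mul]; simp
    simp [hamiltonian, Fin.ext_iff, ← two_mul, hs]
    ring
  · intro j _ hj
    have : (j : ℕ) < n := by
      have := j.2
      have : (j : ℕ) ≠ n := fun h => hj (Fin.ext h)
      omega
    have : (hamiltonian T V (n + 2) x - E • 1) (Fin.last (n + 1)) j.castSucc = 0 := by
      have e1 : ¬ (n + 1 = (j : ℕ)) := by omega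
      have e2 : ¬ (n + 1 + 1 = (j : ℕ)) := by omega
      have e3 : ¬ ((j : ℕ) = n) := by omega
      simp [hamiltonian, Fin.ext_iff, e1, e2, e3]
    rw [this]; simp
  · simp

lemma dirichletDet_eq_monodromy (n : ℕ) (x : Torus d) :
    dirichletDet T V E n x = monodromy T V E n x 0 0 := by
  induction n using Nat.twoStepInduction with
  | zero => simp [dirichletDet, monodromy]
  | one => simp [dirichletDet, monodromy, hamiltonian, stepMatrix]
  | more n h0 h1 =>
    rw [dirichletDet_add_two, h0, h1, monodromy_succ_apply_zero T V E (n + 1),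
      monodromy_succ_apply_one]

end Algebra

/-! ### Operator norm and matrix entries -/

section OpNorm

lemma abs_apply_le_opNorm (M : Matrix (Fin 2) (Fin 2) ℝ) (i j : Fin 2) :
    |M i j| ≤ ‖Matrix.toEuclideanCLM (n := Fin 2) (𝕜 := ℝ) M‖ := by
  have h := (Matrix.toEuclideanCLM (n := Fin 2) (𝕜 := ℝ) M).le_opNorm (EuclideanSpace.single j 1)
  rw [PiLp.norm_single, norm_one, mul_one] at h
  refine le_trans ?_ h
  have h2 := PiLp.norm_apply_le
    (Matrix.toEuclideanCLM (n := Fin 2) (𝕜 := ℝ) M (EuclideanSpace.single j 1)) i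
  have h3 : (Matrix.toEuclideanCLM (n := Fin 2) (𝕜 := ℝ) M (EuclideanSpace.single j 1)) i
      = M i j := by
    simp [Matrix.ofLp_toEuclideanCLM]
  rw [h3] at h2
  simpa using h2

/-- The constant one in front of `a` matters: a nearly diagonal matrix with diagonal entries near
`±1` must get norm near one. -/
lemma opNorm_le_max_add (M : Matrix (Fin 2) (Fin 2) ℝ) (a b : ℝ) (h00 : |M 0 0| ≤ a)
    (h11 : |M 1 1| ≤ a) (h01 : |M 0 1| ≤ b) (h10 : |M 1 0| ≤ b) :
    ‖Matrix.toEuclideanCLM (n := Fin 2) (𝕜 := ℝ) M‖ ≤ a + b := by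
  have ha : 0 ≤ a := (abs_nonneg _).trans h00
  have hb : 0 ≤ b := (abs_nonneg _).trans h01
  refine ContinuousLinearMap.opNorm_le_bound _ (by positivity) fun v => ?_
  rw [EuclideanSpace.norm_eq, EuclideanSpace.norm_eq]
  have hc : 0 ≤ a + b := by positivity
  rw [← Real.sqrt_sq hc, ← Real.sqrt_mul (by positivity)]
  apply Real.sqrt_le_sqrt
  simp only [Fin.sum_univ_two, Real.norm_eq_abs, sq_abs, Matrix.ofLp_toEuclideanCLM,
    Matrix.mulVec, dotProduct]
  set p := v 0
  set q := v 1
  have key : ∀ s t : ℝ, |s| ≤ a → |t| ≤ b → ∀ u w : ℝ,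
      (s * u + t * w) ^ 2 ≤ (a * |u| + b * |w|) ^ 2 := by
    intro s t hs ht u w
    rw [← sq_abs]
    refine pow_le_pow_left₀ (abs_nonneg _) ?_ 2
    refine (abs_add_le _ _).trans ?_
    rw [abs_mul, abs_mul]
    gcongr
  have k1 := key _ _ h00 h01 p q
  have k2 := key _ _ h11 h10 q p
  have e1 := sq_abs p
  have e2 := sq_abs q
  nlinarith [mul_nonneg (mul_nonneg ha hb) (sq_nonneg (|p| - |q|))]

end OpNorm

/-! ### A Remez inequality and a three lines theorem on strips -/

section Strip

open Complex Filter Asymptotics Set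

lemma sinh_eq_re_add_im (w : ℂ) : Complex.sinh w =
    (Real.sinh w.re * Real.cos w.im : ℝ) + (Real.cosh w.re * Real.sin w.im : ℝ) * I := by
  conv_lhs => rw [← Complex.re_add_im w]
  rw [Complex.sinh_add, Complex.sinh_mul_I, Complex.cosh_mul_I]
  push_cast
  ring

lemma cosh_eq_re_add_im (w : ℂ) : Complex.cosh w =
    (Real.cosh w.re * Real.cos w.im : ℝ) + (Real.sinh w.re * Real.sin w.im : ℝ) * I := by
  conv_lhs => rw [← Complex.re_add_im w]
  rw [Complex.cosh_add, Complex.sinh_mul_I, Complex.cosh_mul_I]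
  push_cast
  ring

lemma sq_norm_sinh (w : ℂ) : ‖Complex.sinh w‖ ^ 2 = Real.sinh w.re ^ 2 + Real.sin w.im ^ 2 := by
  rw [sinh_eq_re_add_im, ← Complex.normSq_eq_norm_sq, Complex.normSq_add_mul_I]
  nlinarith [Real.cosh_sq w.re, Real.sin_sq_add_cos_sq w.im]

lemma sq_norm_cosh (w : ℂ) : ‖Complex.cosh w‖ ^ 2 = Real.sinh w.re ^ 2 + Real.cos w.im ^ 2 := by
  rw [cosh_eq_re_add_im, ← Complex.normSq_eq_norm_sq, Complex.normSq_add_mul_I]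
  nlinarith [Real.cosh_sq w.re, Real.sin_sq_add_cos_sq w.im]

lemma sinh_ne_zero_of_abs_im_lt {w : ℂ} (hw : w ≠ 0) (h : |w.im| < Real.pi / 2) :
    Complex.sinh w ≠ 0 := by
  intro h0
  have h1 := sq_norm_sinh w
  rw [h0, norm_zero] at h1
  have hs : Real.sinh w.re = 0 := by
    nlinarith [sq_nonneg (Real.sin w.im), sq_nonneg (Real.sinh w.re)]
  have ht : Real.sin w.im = 0 := by
    nlinarith [sq_nonneg (Real.sin w.im), sq_nonneg (Real.sinh w.re)]
  have hpi := Real.pi_pos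
  obtain ⟨h2, h3⟩ := abs_lt.1 h
  rw [Real.sin_eq_zero_iff_of_lt_of_lt (by linarith) (by linarith)] at ht
  exact hw (Complex.ext (Real.sinh_eq_zero.1 hs) ht)

lemma norm_sinh_eq_norm_cosh {w : ℂ} (h : |w.im| = Real.pi / 4) :
    ‖Complex.sinh w‖ = ‖Complex.cosh w‖ := by
  have : Real.sin w.im ^ 2 = Real.cos w.im ^ 2 := by
    have h2 : Real.sin (Real.pi / 4) ^ 2 = Real.cos (Real.pi / 4) ^ 2 := by
      rw [Real.sin_pi_div_four, Real.cos_pi_div_four]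
    rcases abs_choice w.im with h' | h'
    · rw [← h', h, h2]
    · rw [show w.im = -(Real.pi / 4) by linarith, Real.sin_neg, Real.cos_neg, neg_sq, h2]
  rw [← sq_eq_sq₀ (norm_nonneg _) (norm_nonneg _), sq_norm_sinh, sq_norm_cosh, this]

lemma norm_cosh_le_two_mul_norm_sinh {w : ℂ} (h : 1 ≤ |w.re|) :
    ‖Complex.cosh w‖ ≤ 2 * ‖Complex.sinh w‖ := by
  have h1 : 1 ≤ Real.sinh w.re ^ 2 := by
    rw [← sq_abs, Real.abs_sinh]
    have : |w.re| ≤ Real.sinh |w.re| := Real.self_le_sinh_iff.2 (abs_nonneg _)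
    nlinarith
  have h2 := sq_norm_sinh w
  have h3 := sq_norm_cosh w
  have := Real.cos_sq_le_one w.im
  refine (abs_le_of_sq_le_sq' ?_ (by positivity)).2
  nlinarith [sq_nonneg (Real.sin w.im)]

/-- Division of a function on the strip `|Im z| < 2 h` by the Blaschke factor of the strip
`|Im z| < h` with zero `a`. -/
lemma exists_strip_quotient {h : ℝ} (hh : 0 < h) {φ : ℂ → ℂ}
    (hd : DifferentiableOn ℂ φ {z | |z.im| < 2 * h}) {M : ℝ}
    (hM : ∀ z : ℂ, |z.im| ≤ h → ‖φ z‖ ≤ M) (a : ℝ) :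
    ∃ ψ : ℂ → ℂ, DifferentiableOn ℂ ψ {z | |z.im| < 2 * h} ∧
      (∀ z : ℂ, |z.im| ≤ h → ‖ψ z‖ ≤ M + ‖φ a‖) ∧
      ∀ z : ℂ, |z.im| < 2 * h →
        (φ z - φ a) * Complex.cosh ((Real.pi / (4 * h) : ℝ) * (z - a)) =
          ψ z * Complex.sinh ((Real.pi / (4 * h) : ℝ) * (z - a)) := by
  -- For this `c`, `tanh (c (z - a))` has modulus one on `|Im z| = h`. On `|Im z| < 2 h` the
  -- argument has imaginary part below `π / 2`, so `sinh` vanishes only at `a`.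
  set c : ℝ := Real.pi / (4 * h) with hc
  have hcpos : 0 < c := by positivity
  have hch : c * h = Real.pi / 4 := by rw [hc]; field_simp
  set U : Set ℂ := {z | |z.im| < 2 * h} with hU
  have hUo : IsOpen U := isOpen_lt (by fun_prop) (by fun_prop)
  have haU : U ∈ nhds (a : ℂ) := hUo.mem_nhds (by simp [hU]; positivity)
  set S : ℂ → ℂ := fun z => Complex.sinh (c * (z - a)) with hS
  have hSd : Differentiable ℂ S := by
    intro z
    simp only [hS]
    fun_prop
  have hS0 : S a = 0 := by simp [hS]
  have hmul : ∀ z : ℂ, (z - a) * dslope S a z = S z := by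
    intro z
    have := sub_smul_dslope S (a : ℂ) z
    rwa [smul_eq_mul, hS0, sub_zero] at this
  have hmulφ : ∀ z : ℂ, (z - a) * dslope φ a z = φ z - φ a := by
    intro z
    simpa [smul_eq_mul] using sub_smul_dslope φ (a : ℂ) z
  have him : ∀ z : ℂ, ((c : ℂ) * (z - a)).im = c * z.im := by intro z; simp
  have hre : ∀ z : ℂ, ((c : ℂ) * (z - a)).re = c * (z.re - a) := by intro z; simp
  have hne : ∀ z ∈ U, dslope S a z ≠ 0 := by
    intro z hz
    by_cases hza : z = a
    · subst hza
      rw [dslope_same]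
      have : HasDerivAt S (Complex.cosh (c * ((a : ℂ) - a)) * (c * 1)) a := by
        simp only [hS]
        exact (((hasDerivAt_id (a : ℂ)).sub_const (a : ℂ)).const_mul (c : ℂ)).csinh
      rw [this.deriv]
      simp [hcpos.ne']
    · intro h0
      have h1 := hmul z
      rw [h0, mul_zero] at h1
      refine sinh_ne_zero_of_abs_im_lt (w := c * (z - a)) ?_ ?_ h1.symm
      · exact mul_ne_zero (by exact_mod_cast hcpos.ne') (sub_ne_zero.2 hza)
      · rw [him, abs_mul, abs_of_pos hcpos]
        have : c * |z.im| < c * (2 * h) := by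
          have : |z.im| < 2 * h := hz
          gcongr
        linarith
  -- The quotient of `φ - φ a` by the hyperbolic tangent. Replacing both vanishing factors by their
  -- slopes removes the singularity at `a`.
  set ψ : ℂ → ℂ := fun z => dslope φ a z * Complex.cosh (c * (z - a)) / dslope S a z with hψ
  have hψd : DifferentiableOn ℂ ψ U := by
    refine DifferentiableOn.div (DifferentiableOn.mul ?_ ?_) ?_ hne
    · exact (Complex.differentiableOn_dslope haU).2 hd
    · fun_prop
    · exact (Complex.differentiableOn_dslope haU).2 hSd.differentiableOn
  have hid : ∀ z ∈ U, (φ z - φ a) * Complex.cosh (c * (z - a)) = ψ z * S z := by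
    intro z hz
    rw [← hmul z, ← hmulφ z, hψ]
    field_simp [hne z hz]
  have hbd : ∀ z : ℂ, |z.im| ≤ h → ‖φ z - φ a‖ ≤ M + ‖φ a‖ := fun z hz =>
    (norm_sub_le _ _).trans (by gcongr; exact hM z hz)
  have hsub : ∀ z : ℂ, |z.im| ≤ h → z ∈ U := fun z hz => by
    change |z.im| < 2 * h; linarith
  have hnorm : ∀ z : ℂ, |z.im| ≤ h →
      ‖φ z - φ a‖ * ‖Complex.cosh (c * (z - a))‖ = ‖ψ z‖ * ‖S z‖ := by
    intro z hz
    rw [← norm_mul, hid z (hsub z hz), norm_mul]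
  have hSne : ∀ z : ℂ, |z.im| ≤ h → z ≠ a → 0 < ‖S z‖ := by
    intro z hz hza
    rw [norm_pos_iff, ← hmul z]
    exact mul_ne_zero (sub_ne_zero.2 hza) (hne z (hsub z hz))
  have hedge : ∀ z : ℂ, |z.im| = h → ‖ψ z‖ ≤ M + ‖φ a‖ := by
    intro z hz
    have e1 : ‖S z‖ = ‖Complex.cosh (c * (z - a))‖ := by
      apply norm_sinh_eq_norm_cosh
      rw [him, abs_mul, abs_of_pos hcpos, hz, hch]
    have e2 := hnorm z hz.le
    have e3 : 0 < ‖S z‖ := hSne z hz.le (by rintro rfl; simp at hz; linarith)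
    rw [← e1] at e2
    rw [← mul_right_cancel₀ e3.ne' e2]
    exact hbd z hz.le
  refine ⟨ψ, hψd, ?_, hid⟩
  intro z hz
  obtain ⟨hz1, hz2⟩ := abs_le.1 hz
  refine PhragmenLindelof.horizontal_strip (a := -h) (b := h) (f := ψ) ?_ ?_ ?_ ?_ hz1 hz2
  · apply DifferentiableOn.diffContOnCl
    refine hψd.mono ?_
    have hcl : IsClosed (Complex.im ⁻¹' Icc (-h) h) := isClosed_Icc.preimage Complex.continuous_im
    refine (closure_minimal (preimage_mono Ioo_subset_Icc_self) hcl).trans ?_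
    intro w hw
    exact hsub w (abs_le.2 hw)
  · refine ⟨0, by apply div_pos Real.pi_pos; linarith, 0, ?_⟩
    simp only [zero_mul, Real.exp_zero]
    -- Far from `a` along the strip the Blaschke factor is at least one half in modulus, so `ψ` is
    -- bounded there, as Phragmén–Lindelöf requires.
    refine IsBigO.of_bound (2 * (M + ‖φ a‖)) ?_
    have h1 : ∀ᶠ z : ℂ in comap (abs ∘ Complex.re) atTop, 1 / c + |a| ≤ |z.re| :=
      (eventually_ge_atTop _).comap _
    filter_upwards [h1.filter_mono inf_le_left, mem_inf_of_right (mem_principal_self _)]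
      with w hw1 hw2
    have hwi : |w.im| ≤ h := abs_le.2 ⟨hw2.1.le, hw2.2.le⟩
    have hcw : ‖Complex.cosh (c * (w - a))‖ ≤ 2 * ‖S w‖ := by
      apply norm_cosh_le_two_mul_norm_sinh
      rw [hre, abs_mul, abs_of_pos hcpos]
      have : 1 / c ≤ |w.re - a| := by
        have := abs_sub_abs_le_abs_sub w.re a
        linarith
      calc 1 = c * (1 / c) := by field_simp
        _ ≤ _ := by gcongr
    have hwa : w ≠ a := by
      rintro rfl
      have : 0 < 1 / c := by positivity
      simp only [Complex.ofReal_re] at hw1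
      linarith
    have e3 := hSne w hwi hwa
    rw [norm_one, mul_one]
    refine le_of_mul_le_mul_right ?_ e3
    rw [← hnorm w hwi]
    calc _ ≤ (M + ‖φ a‖) * (2 * ‖S w‖) := by
          gcongr
          · exact (norm_nonneg _).trans (hbd w hwi)
          · exact hbd w hwi
      _ = _ := by ring
  · intro w hw
    exact hedge w (by rw [hw, abs_neg, abs_of_pos hh])
  · intro w hw
    exact hedge w (by rw [hw, abs_of_pos hh])

/-- A bounded function on a strip that is small at `k` separated real points is small
on the interval. -/
lemma norm_le_of_small_at_nodes {h : ℝ} (hh : 0 < h) {δ : ℝ} (hδ : 0 < δ) (l : List ℝ)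
    (hl01 : ∀ y ∈ l, y ∈ Icc (0 : ℝ) 1) (hsep : l.Pairwise fun y y' => δ ≤ |y - y'|)
    {x : ℝ} (hx : x ∈ Icc (0 : ℝ) 1) :
    ∀ {φ : ℂ → ℂ} (_ : DifferentiableOn ℂ φ {z | |z.im| < 2 * h}) {M ε : ℝ}
      (_ : ∀ z : ℂ, |z.im| ≤ h → ‖φ z‖ ≤ M) (_ : 0 ≤ ε) (_ : ∀ y ∈ l, ‖φ (y : ℝ)‖ ≤ ε),
      ‖φ (x : ℝ)‖ ≤ Real.tanh (Real.pi / (4 * h)) ^ l.length * M +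
        ε * (2 * Real.cosh (Real.pi / (4 * h)) / (Real.pi / (4 * h)) / δ + 2) ^ l.length := by
  set c : ℝ := Real.pi / (4 * h) with hc
  have hcpos : 0 < c := by positivity
  set D : ℝ := 2 * Real.cosh c / c / δ with hD
  have hDpos : 0 < D := by have := Real.cosh_pos c; positivity
  have hq0 : 0 ≤ Real.tanh c := by
    rw [Real.tanh_eq_sinh_div_cosh]
    exact div_nonneg (Real.sinh_nonneg_iff.2 hcpos.le) (Real.cosh_pos c).le
  have hq1 : Real.tanh c ≤ 1 := (Real.tanh_lt_one c).le
  induction l with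
  | nil =>
    intro φ _ M ε hM hε _
    simp only [List.length_nil, pow_zero, one_mul, mul_one]
    linarith [hM x (by simp [hh.le])]
  | cons a l ih =>
    intro φ hd M ε hM hε hnode
    -- Dividing out one node raises the global bound from `M` to `M + ε` and the bound at the other
    -- nodes by a factor `D`, while the value at `x` gains a factor `tanh c`.
    obtain ⟨ψ, hψd, hψM, hψ⟩ := exists_strip_quotient hh hd hM a
    rw [← hc] at hψ
    have ha : ‖φ a‖ ≤ ε := hnode a (by simp)
    have hM0 : 0 ≤ M := (norm_nonneg _).trans (hM 0 (by simp [hh.le]))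
    have hreal : ∀ y : ℝ, ‖φ y - φ a‖ * Real.cosh (c * (y - a)) =
        ‖ψ y‖ * |Real.sinh (c * (y - a))| := by
      intro y
      have := hψ y (by simp [hh])
      have h2 := congrArg norm this
      rw [norm_mul, norm_mul] at h2
      rw [show (c : ℂ) * (y - a) = ((c * (y - a) : ℝ) : ℂ) by push_cast; ring,
        ← Complex.ofReal_cosh, ← Complex.ofReal_sinh, Complex.norm_real, Complex.norm_real] at h2
      simpa [Real.norm_eq_abs, abs_of_pos (Real.cosh_pos _)] using h2
    have ha01 := hl01 a (by simp)
    have hdist : ∀ y ∈ Icc (0 : ℝ) 1, |c * (y - a)| ≤ c := by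
      intro y hy
      rw [abs_mul, abs_of_pos hcpos]
      have : |y - a| ≤ 1 := by
        rw [abs_le]; constructor <;> linarith [hy.1, hy.2, ha01.1, ha01.2]
      nlinarith
    rw [List.pairwise_cons] at hsep
    have hψnode : ∀ y ∈ l, ‖ψ (y : ℝ)‖ ≤ ε * D := by
      intro y hy
      have hs := hsep.1 y hy
      have hy01 := hl01 y (by simp [hy])
      have h1 := hreal y
      have h2 : c * δ ≤ |Real.sinh (c * (y - a))| := by
        rw [Real.abs_sinh]
        refine le_trans ?_ (Real.self_le_sinh_iff.2 (abs_nonneg _))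
        rw [abs_mul, abs_of_pos hcpos, abs_sub_comm]
        gcongr
      have h3 : Real.cosh (c * (y - a)) ≤ Real.cosh c := by
        rw [Real.cosh_le_cosh, abs_of_pos hcpos]
        exact hdist y hy01
      have h4 : ‖φ y - φ a‖ ≤ 2 * ε := by
        refine (norm_sub_le _ _).trans ?_
        linarith [hnode y (by simp [hy])]
      have h5 : ‖ψ y‖ * (c * δ) ≤ 2 * ε * Real.cosh c := by
        calc _ ≤ ‖ψ y‖ * |Real.sinh (c * (y - a))| := by gcongr
          _ = ‖φ y - φ a‖ * Real.cosh (c * (y - a)) := h1.symm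
          _ ≤ _ := by gcongr
      rw [hD]
      rw [← le_div_iff₀ (by positivity)] at h5
      refine h5.trans (le_of_eq ?_)
      field_simp
    have hψx := ih (fun y hy => hl01 y (by simp [hy])) hsep.2 hψd
      (M := M + ε) (fun z hz => (hψM z hz).trans (by gcongr)) (ε := ε * D) (by positivity) hψnode
    -- Both `x` and `a` lie in `[0,1]`, so the Blaschke factor at `x` is at most `tanh c < 1`.
    have hφx : ‖φ x‖ ≤ ε + Real.tanh c * ‖ψ x‖ := by
      have h1 := hreal x
      have h2 : |Real.sinh (c * (x - a))| ≤ Real.tanh c * Real.cosh (c * (x - a)) := by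
        have hcp := Real.cosh_pos (c * (x - a))
        rw [← div_le_iff₀ hcp]
        have : |Real.sinh (c * (x - a))| / Real.cosh (c * (x - a)) = Real.tanh |c * (x - a)| := by
          rw [Real.tanh_eq_sinh_div_cosh, Real.abs_sinh, Real.cosh_abs]
        rw [this]
        have hu := hdist x hx
        have hw0 := abs_nonneg (c * (x - a))
        generalize |c * (x - a)| = u at hu hw0
        rw [Real.tanh_eq_sinh_div_cosh, Real.tanh_eq_sinh_div_cosh,
          div_le_div_iff₀ (Real.cosh_pos _) (Real.cosh_pos _), ← sub_nonneg]
        have : 0 ≤ Real.sinh (c - u) := Real.sinh_nonneg_iff.2 (by linarith)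
        rw [Real.sinh_sub] at this
        linarith
      have h3 : ‖φ x - φ a‖ ≤ Real.tanh c * ‖ψ x‖ := by
        have hcp := Real.cosh_pos (c * (x - a))
        refine le_of_mul_le_mul_right ?_ hcp
        rw [h1]
        calc _ ≤ ‖ψ x‖ * (Real.tanh c * Real.cosh (c * (x - a))) := by gcongr
          _ = _ := by ring
      have h4 : φ x = φ a + (φ x - φ a) := by ring
      rw [h4]
      exact (norm_add_le _ _).trans (by gcongr)
    rw [List.length_cons]
    set q := Real.tanh c
    set k := l.length
    have hqk : q ^ (k + 1) ≤ 1 := pow_le_one₀ hq0 hq1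
    have hone : 1 ≤ (D + 2) ^ k := one_le_pow₀ (by linarith)
    calc ‖φ x‖ ≤ ε + q * (q ^ k * (M + ε) + ε * D * (D + 2) ^ k) := by
          refine hφx.trans ?_
          gcongr
      _ = q ^ (k + 1) * M + ε * (1 + q ^ (k + 1) + q * (D * (D + 2) ^ k)) := by ring
      _ ≤ q ^ (k + 1) * M + ε * (1 + 1 + 1 * (D * (D + 2) ^ k)) := by gcongr
      _ ≤ q ^ (k + 1) * M + ε * (D + 2) ^ (k + 1) := by
          gcongr
          rw [pow_succ]
          nlinarith

/-- Greedy choice: the intervals of radius `δ` around the points chosen so far have total length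
less than the measure of `S`. -/
lemma exists_separated_list {S : Set ℝ} {lam δ : ℝ} (k : ℕ) (hδ : 0 < δ)
    (hk : 2 * δ * k ≤ lam) (hS : ENNReal.ofReal lam ≤ volume S) :
    ∃ l : List ℝ, l.length = k ∧ (∀ y ∈ l, y ∈ S) ∧ l.Pairwise fun y y' => δ ≤ |y - y'| := by
  induction k with
  | zero => exact ⟨[], by simp⟩
  | succ k ih =>
    push_cast at hk
    obtain ⟨l, hlen, hlS, hsep⟩ := ih (by nlinarith)
    have hvol : volume (⋃ y ∈ l.toFinset, Metric.ball y δ) < volume S := by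
      calc volume (⋃ y ∈ l.toFinset, Metric.ball y δ)
          ≤ ∑ y ∈ l.toFinset, volume (Metric.ball y δ) := measure_biUnion_finset_le _ _
        _ = l.toFinset.card • ENNReal.ofReal (2 * δ) := by simp [Real.volume_ball]
        _ ≤ k • ENNReal.ofReal (2 * δ) := by
            gcongr
            rw [← hlen]; exact List.toFinset_card_le l
        _ = ENNReal.ofReal (k * (2 * δ)) := by
            rw [nsmul_eq_mul, ENNReal.ofReal_mul (p := (k : ℝ)) (by positivity),
              ENNReal.ofReal_natCast]
        _ < ENNReal.ofReal lam := by
            rw [ENNReal.ofReal_lt_ofReal_iff_of_nonneg (by positivity)]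
            nlinarith
        _ ≤ volume S := hS
    obtain ⟨y, hyS, hy⟩ : ∃ y ∈ S, y ∉ ⋃ y ∈ l.toFinset, Metric.ball y δ := by
      by_contra! hcon
      exact absurd (measure_mono hcon) (not_le.2 hvol)
    refine ⟨y :: l, by simp [hlen], ?_, ?_⟩
    · simpa [hyS] using hlS
    · rw [List.pairwise_cons]
      refine ⟨fun z hz => ?_, hsep⟩
      simp only [mem_iUnion, not_exists] at hy
      have := hy z (by simpa using hz)
      rw [Metric.mem_ball, not_lt, Real.dist_eq] at this
      exact this

/-- Remez-type inequality on a strip. -/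
lemma strip_remez {h : ℝ} (hh : 0 < h) {φ : ℂ → ℂ}
    (hd : DifferentiableOn ℂ φ {z | |z.im| < 2 * h}) {M ε lam : ℝ}
    (hM : ∀ z : ℂ, |z.im| ≤ h → ‖φ z‖ ≤ M) (hε : 0 ≤ ε) (hlam : 0 < lam) {S : Set ℝ}
    (hS01 : S ⊆ Icc 0 1) (hS : ENNReal.ofReal lam ≤ volume S) (hSε : ∀ y ∈ S, ‖φ (y : ℝ)‖ ≤ ε)
    {k : ℕ} (hk : 0 < k) {x : ℝ} (hx : x ∈ Icc (0 : ℝ) 1) :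
    ‖φ (x : ℝ)‖ ≤ Real.tanh (Real.pi / (4 * h)) ^ k * M +
      ε * (4 * Real.cosh (Real.pi / (4 * h)) / (Real.pi / (4 * h)) * k / lam + 2) ^ k := by
  have hk' : (0 : ℝ) < k := by exact_mod_cast hk
  obtain ⟨l, hlen, hlS, hsep⟩ := exists_separated_list (S := S) (lam := lam)
    (δ := lam / (2 * k)) k (by positivity) (by field_simp; exact le_refl _) hS
  have := norm_le_of_small_at_nodes hh (δ := lam / (2 * k)) (by positivity) l
    (fun y hy => hS01 (hlS y hy)) hsep hx hd hM hε (fun y hy => hSε y (hlS y hy))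
  rw [hlen] at this
  refine this.trans (le_of_eq ?_)
  congr 3
  field_simp
  ring

/-- A function on a strip, bounded by `exp a` on the real line and by `exp b` in the strip, is
bounded by `exp (a + b * |Im z| / h)`. -/
lemma norm_le_exp_of_strip {h : ℝ} (hh : 0 < h) {φ : ℂ → ℂ}
    (hd : DifferentiableOn ℂ φ {z | |z.im| < 2 * h}) {a b : ℝ} (ha : 0 ≤ a)
    (hb : ∀ z : ℂ, |z.im| ≤ h → ‖φ z‖ ≤ Real.exp b)
    (hreal : ∀ x : ℝ, ‖φ x‖ ≤ Real.exp a) {z : ℂ} (hz : |z.im| ≤ h) :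
    ‖φ z‖ ≤ Real.exp (a + b * |z.im| / h) := by
  wlog him : 0 ≤ z.im generalizing φ z
  · have hneg : ∀ w : ℂ, |(-w).im| = |w.im| := fun w => by simp
    have := this (φ := fun w => φ (-w)) (z := -z) ?_ ?_ ?_ (by rwa [hneg]) (by simp; linarith)
    · simpa using this
    · refine hd.comp (by fun_prop) ?_
      intro w hw
      simpa using hw
    · intro w hw; exact hb _ (by rwa [hneg])
    · intro x; simpa using hreal (-x)
  rw [abs_of_nonneg him] at hz ⊢
  -- The factor `exp (i t w)` has modulus one on the real line and `exp (-b)` on `Im w = h`, so the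
  -- product is at most `exp a` on both edges.
  set t : ℝ := b / h with ht
  set ψ : ℂ → ℂ := fun w => φ w * Complex.exp (I * (t : ℂ) * w) with hψ
  have hn : ∀ w : ℂ, ‖ψ w‖ = ‖φ w‖ * Real.exp (-(t * w.im)) := by
    intro w
    simp [hψ, Complex.norm_exp]
  have key : ‖ψ z‖ ≤ Real.exp a := by
    refine PhragmenLindelof.horizontal_strip (a := 0) (b := h) (f := ψ) ?_ ?_ ?_ ?_ him hz
    · apply DifferentiableOn.diffContOnCl
      have hcl : IsClosed (Complex.im ⁻¹' Icc 0 h) := isClosed_Icc.preimage Complex.continuous_im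
      have hsub : closure (Complex.im ⁻¹' Ioo 0 h) ⊆ {z | |z.im| < 2 * h} := by
        refine (closure_minimal (preimage_mono Ioo_subset_Icc_self) hcl).trans ?_
        intro w hw
        change |w.im| < 2 * h
        rw [abs_of_nonneg hw.1]
        linarith [hw.2]
      exact (hd.mono hsub).mul (by fun_prop)
    · refine ⟨0, by apply div_pos Real.pi_pos; linarith, 0, ?_⟩
      simp only [zero_mul, Real.exp_zero]
      refine IsBigO.of_bound (Real.exp b * Real.exp (|t| * h)) ?_
      filter_upwards [mem_inf_of_right (mem_principal_self _)] with w hw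
      rw [hn, norm_one, mul_one]
      have hw' : |w.im| ≤ h := by rw [abs_of_pos hw.1]; exact hw.2.le
      gcongr
      · exact hb w hw'
      · calc -(t * w.im) ≤ |t * w.im| := neg_le_abs _
          _ = |t| * |w.im| := abs_mul _ _
          _ ≤ _ := by gcongr
    · intro w hw
      rw [hn, hw]
      have : w = (w.re : ℂ) := Complex.ext (by simp) (by simp [hw])
      rw [this]
      simpa using hreal w.re
    · intro w hw
      rw [hn, hw]
      calc ‖φ w‖ * Real.exp (-(t * h)) ≤ Real.exp b * Real.exp (-(t * h)) := by
            gcongr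
            exact hb w (by rw [hw, abs_of_pos hh])
        _ = 1 := by rw [← Real.exp_add, ht]; simp; field_simp; simp
        _ ≤ _ := Real.one_le_exp ha
  rw [hn] at key
  rw [Real.exp_add, ← div_le_iff₀ (Real.exp_pos _)]
  refine le_trans (le_of_eq ?_) key
  rw [div_eq_mul_inv, ← Real.exp_neg, ht]
  congr 3
  ring

end Strip

/-! ### Slicing the torus by segments, and recurrence -/

section Measure

open Set

instance isProbabilityMeasure_unitAddCircle :
    IsProbabilityMeasure (volume : Measure UnitAddCircle) :=
  ⟨UnitAddCircle.measure_univ⟩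

/-- The projection `ℝ^d → 𝕋^d`. -/
def proj {d : ℕ} (u : Fin d → ℝ) : Torus d := fun i => (u i : UnitAddCircle)

lemma continuous_proj {d : ℕ} : Continuous (proj : (Fin d → ℝ) → Torus d) :=
  continuous_pi fun i => (AddCircle.continuous_mk' (1 : ℝ)).comp (continuous_apply i)

/-- Every point of the torus has a lift of the same norm. -/
lemma exists_proj_eq {d : ℕ} (x : Torus d) : ∃ u : Fin d → ℝ, proj u = x ∧ ‖u‖ = ‖x‖ := by
  have h : ∀ i, ∃ t : ℝ, (t : UnitAddCircle) = x i ∧ ‖t‖ = ‖x i‖ := by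
    intro i
    obtain ⟨t, ht⟩ := QuotientAddGroup.mk_surjective (x i)
    refine ⟨t - round t, ?_, ?_⟩
    · rw [← ht]
      have : ((round t : ℤ) : ℝ) = (round t : ℤ) • (1 : ℝ) := by simp
      rw [AddCircle.coe_sub, this, AddCircle.coe_zsmul, AddCircle.coe_period]
      simp
    · rw [← ht]
      exact (UnitAddCircle.norm_eq (x := t)).symm
  choose u hu hn using h
  refine ⟨u, funext hu, ?_⟩
  simp only [Pi.norm_def, nnnorm]
  congr 2
  funext i
  exact Subtype.ext (hn i)

/-- The fundamental cell is centred at `0`, so that on it the circle norm is the absolute value and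
small balls lift to balls. -/
lemma measurePreserving_proj (d : ℕ) :
    MeasurePreserving (proj : (Fin d → ℝ) → Torus d)
      (volume.restrict (univ.pi fun _ => Ioc (-(1 / 2) : ℝ) (-(1 / 2) + 1))) volume := by
  have := measurePreserving_pi (ι := Fin d)
    (fun _ => (volume : Measure ℝ).restrict (Ioc (-(1 / 2) : ℝ) (-(1 / 2) + 1)))
    (fun _ => (volume : Measure UnitAddCircle))
    (fun _ => UnitAddCircle.measurePreserving_mk (-(1 / 2)))
  rw [← Measure.restrict_pi_pi] at this
  exact this

/-- Through every point of the torus there is a segment that meets a given set in a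
proportion not smaller, up to a factor, than the proportion of the set in a ball. -/
lemma exists_segment {d : ℕ} (x₀ : Torus d) {r : ℝ} (hr0 : 0 < r) {S : Set (Torus d)}
    (hS : MeasurableSet S) :
    ∃ v : Fin d → ℝ, ‖v‖ ≤ 2 * r ∧ volume (S ∩ Metric.closedBall x₀ r) ≤
      2 * ENNReal.ofReal ((4 * r) ^ d) * volume {s ∈ Icc (0 : ℝ) 1 | x₀ + proj (s • v) ∈ S} := by
  set Q : Set (Fin d → ℝ) := univ.pi fun _ => Ioc (-(1 / 2) : ℝ) (-(1 / 2) + 1) with hQ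
  have hQm : MeasurableSet Q := MeasurableSet.univ_pi fun _ => measurableSet_Ioc
  set g : (Fin d → ℝ) → Torus d := fun u => x₀ + proj u with hg
  have hgc : Continuous g := continuous_const.add continuous_proj
  have hgm : MeasurePreserving g (volume.restrict Q) volume :=
    (measurePreserving_add_left volume x₀).comp (measurePreserving_proj d)
  set A : Set (Fin d → ℝ) := g ⁻¹' (S ∩ Metric.closedBall x₀ r) ∩ Q with hA
  have hSr : MeasurableSet (S ∩ Metric.closedBall x₀ r) := hS.inter measurableSet_closedBall
  have hAm : MeasurableSet A := (hgc.measurable hSr).inter hQm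
  have hAvol : volume A = volume (S ∩ Metric.closedBall x₀ r) := by
    rw [← hgm.measure_preimage hSr.nullMeasurableSet, Measure.restrict_apply (hgc.measurable hSr)]
  have hAr : ∀ u ∈ A, ‖u‖ ≤ r := by
    intro u hu
    have h1 : ‖proj u‖ ≤ r := by
      have := hu.1.2
      rw [hg, Metric.mem_closedBall, dist_eq_norm] at this
      simpa using this
    refine (pi_norm_le_iff_of_nonneg hr0.le).2 fun i => ?_
    have h2 : ‖(u i : UnitAddCircle)‖ ≤ r := (norm_le_pi_norm (proj u) i).trans h1
    have h3 : u i ∈ Ioc (-(1 / 2) : ℝ) (-(1 / 2) + 1) := hu.2 i (mem_univ i)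
    rwa [(AddCircle.norm_coe_eq_abs_iff 1 one_ne_zero).2
      (by rw [abs_le]; norm_num; constructor <;> linarith [h3.1, h3.2])] at h2
  -- Fubini replaces polar coordinates. For fixed `s ≤ 1` the section in `v` is a dilate of `A`, of
  -- volume at least that of `A`. As `s ≥ 1 / 2`, only `‖v‖ ≤ 2 r` contributes, a ball of volume `(4
  -- r)^d`; some `v` does at least as well as the average.
  set P : Set (ℝ × (Fin d → ℝ)) := {p | p.1 ∈ Icc (1 / 2 : ℝ) 1 ∧ p.1 • p.2 ∈ A} with hP
  have hPm : MeasurableSet P :=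
    (measurable_fst measurableSet_Icc).inter
      ((measurable_fst.smul measurable_snd : Measurable fun p : ℝ × (Fin d → ℝ) => p.1 • p.2) hAm)
  have hlow : (1 / 2 : ENNReal) * volume A ≤ (volume.prod volume) P := by
    rw [Measure.prod_apply hPm]
    calc (1 / 2 : ENNReal) * volume A = ∫⁻ _ in Icc (1 / 2 : ℝ) 1, volume A := by
          rw [lintegral_const, Measure.restrict_apply_univ, Real.volume_Icc, mul_comm]
          congr 1
          rw [show (1 - 1 / 2 : ℝ) = 1 / 2 by norm_num, ENNReal.ofReal_div_of_pos (by norm_num)]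
          simp
      _ ≤ ∫⁻ s in Icc (1 / 2 : ℝ) 1, volume (Prod.mk s ⁻¹' P) := by
          refine setLIntegral_mono' measurableSet_Icc fun s hs => ?_
          have hs0 : (0 : ℝ) < s := lt_of_lt_of_le (by norm_num) hs.1
          have : Prod.mk s ⁻¹' P = (fun u => s • u) ⁻¹' A := by
            ext u
            simp only [hP, mem_preimage, mem_ofPred_eq]
            exact and_iff_right hs
          rw [this, Measure.addHaar_preimage_smul volume hs0.ne']
          refine le_mul_of_one_le_left (zero_le) ?_
          rw [ENNReal.one_le_ofReal, abs_of_nonneg (by positivity)]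
          exact (one_le_inv₀ (by positivity)).2 (pow_le_one₀ hs0.le hs.2)
      _ ≤ _ := setLIntegral_le_lintegral _ _
  rw [Measure.prod_apply_symm hPm] at hlow
  by_contra! hcon
  have hlt : volume A ≠ 0 := by
    have := hcon 0 (by simp; positivity)
    rw [hAvol]
    exact (lt_of_le_of_lt (zero_le) this).ne'
  have hAfin : volume A ≠ ⊤ := by rw [hAvol]; exact measure_ne_top _ _
  have hc0 : ENNReal.ofReal ((4 * r) ^ d) ≠ 0 := by
    rw [Ne, ENNReal.ofReal_eq_zero, not_le]; positivity
  have hzero : ∀ v, v ∉ Metric.closedBall (0 : Fin d → ℝ) (2 * r) →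
      volume ((fun s => (s, v)) ⁻¹' P) = 0 := by
    intro v hv
    have : (fun s : ℝ => (s, v)) ⁻¹' P = ∅ := by
      rw [eq_empty_iff_forall_notMem]
      rintro s ⟨hs, hsv⟩
      apply hv
      have h1 := hAr _ hsv
      simp only at hs h1
      rw [norm_smul, Real.norm_eq_abs, abs_of_pos (by linarith [hs.1])] at h1
      rw [mem_closedBall_zero_iff]
      nlinarith [hs.1, norm_nonneg v]
    rw [this, measure_empty]
  have hup : ∀ v ∈ Metric.closedBall (0 : Fin d → ℝ) (2 * r),
      volume ((fun s => (s, v)) ⁻¹' P) ≤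
        volume {s ∈ Icc (0 : ℝ) 1 | x₀ + proj (s • v) ∈ S} := by
    intro v _
    apply measure_mono
    rintro s ⟨hs, hsv⟩
    exact ⟨⟨by linarith [hs.1], hs.2⟩, hsv.1.1⟩
  set a : ENNReal := (1 / 2) * volume A / ENNReal.ofReal ((4 * r) ^ d) with ha
  have hlt2 : ∀ v ∈ Metric.closedBall (0 : Fin d → ℝ) (2 * r),
      volume ((fun s => (s, v)) ⁻¹' P) < a := by
    intro v hv
    refine (hup v hv).trans_lt ?_
    have := hcon v (by simpa using hv)
    rw [← hAvol] at this
    rw [ha, ENNReal.lt_div_iff_mul_lt (Or.inl hc0) (Or.inl ENNReal.ofReal_ne_top)]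
    have h2 : (1 / 2 : ENNReal) * (2 * ENNReal.ofReal ((4 * r) ^ d) *
        volume {s ∈ Icc (0 : ℝ) 1 | x₀ + proj (s • v) ∈ S}) < (1 / 2) * volume A :=
      (ENNReal.mul_lt_mul_iff_right (by simp) (by simp)).2 this
    refine lt_of_eq_of_lt ?_ h2
    rw [← mul_assoc, ← mul_assoc, ENNReal.div_mul_cancel (by simp) (by simp), one_mul, mul_comm]
  have hstrict : ∫⁻ v, volume ((fun s => (s, v)) ⁻¹' P) < (1 / 2 : ENNReal) * volume A := by
    have hball : volume (Metric.closedBall (0 : Fin d → ℝ) (2 * r)) =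
        ENNReal.ofReal ((4 * r) ^ d) := by
      rw [Real.volume_pi_closedBall _ (by positivity), Fintype.card_fin]
      congr 2; ring
    calc ∫⁻ v, volume ((fun s => (s, v)) ⁻¹' P)
        = ∫⁻ v in Metric.closedBall (0 : Fin d → ℝ) (2 * r), volume ((fun s => (s, v)) ⁻¹' P) := by
          rw [setLIntegral_eq_of_support_subset]
          intro v hv
          by_contra h
          exact hv (hzero v h)
      _ < ∫⁻ _ in Metric.closedBall (0 : Fin d → ℝ) (2 * r), a := by
          refine setLIntegral_strict_mono measurableSet_closedBall ?_ measurable_const ?_ ?_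
          · rw [hball]; exact hc0
          · refine ne_top_of_le_ne_top ?_
              (setLIntegral_mono' measurableSet_closedBall fun v hv => (hlt2 v hv).le)
            rw [setLIntegral_const, hball]
            refine ENNReal.mul_ne_top ?_ ENNReal.ofReal_ne_top
            exact ENNReal.div_ne_top (ENNReal.mul_ne_top (by simp) hAfin) hc0
          · exact Filter.Eventually.of_forall hlt2
      _ = _ := by
          rw [setLIntegral_const, hball, ha, ENNReal.div_mul_cancel hc0 ENNReal.ofReal_ne_top]
  exact absurd hlow (not_le.2 hstrict)

lemma volume_closedBall_torus {d : ℕ} (x : Torus d) {r : ℝ} (hr0 : 0 ≤ r) (hr : r ≤ 1 / 2) :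
    volume (Metric.closedBall x r) = ENNReal.ofReal ((2 * r) ^ d) := by
  rw [volume_pi_closedBall x hr0]
  simp only [AddCircle.volume_closedBall]
  rw [min_eq_right (by linarith), Finset.prod_const, Finset.card_univ, Fintype.card_fin,
    ENNReal.ofReal_pow (by positivity)]

/-- Some ball contains its share of a given set. -/
lemma exists_ball_inter_ge {d : ℕ} {S : Set (Torus d)} (hS : MeasurableSet S) {r : ℝ}
    (hr0 : 0 ≤ r) (hr : r ≤ 1 / 2) :
    ∃ y : Torus d, volume S * ENNReal.ofReal ((2 * r) ^ d) ≤
      volume (S ∩ Metric.closedBall y r) := by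
  -- Averaging over the centre: the mean of the measure of `S` in the ball is exactly the left side
  -- of the claim.
  set P : Set (Torus d × Torus d) := {p | p.2 ∈ S ∧ dist p.2 p.1 ≤ r} with hP
  have hPm : MeasurableSet P :=
    (measurable_snd hS).inter
      (measurableSet_le (measurable_snd.dist measurable_fst) measurable_const)
  have h1 := Measure.prod_apply (μ := (volume : Measure (Torus d)))
    (ν := (volume : Measure (Torus d))) hPm
  have h2 := Measure.prod_apply_symm (μ := (volume : Measure (Torus d)))
    (ν := (volume : Measure (Torus d))) hPm
  have h3 : ∫⁻ x, volume ((fun y => (y, x)) ⁻¹' P) = volume S * ENNReal.ofReal ((2 * r) ^ d) := by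
    have : ∀ x : Torus d, volume ((fun y => (y, x)) ⁻¹' P) =
        S.indicator (fun _ => ENNReal.ofReal ((2 * r) ^ d)) x := by
      intro x
      by_cases hx : x ∈ S
      · rw [indicator_of_mem hx, ← volume_closedBall_torus x hr0 hr]
        congr 1
        ext y
        simp [hP, hx, dist_comm]
      · rw [indicator_of_notMem hx]
        have : (fun y => (y, x)) ⁻¹' P = ∅ := by
          ext y
          simp [hP, hx]
        rw [this, measure_empty]
    simp_rw [this]
    rw [lintegral_indicator_const hS, mul_comm]
  have h4 : ∀ y : Torus d, Prod.mk y ⁻¹' P = S ∩ Metric.closedBall y r := by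
    intro y; ext x; simp [hP]
  simp_rw [h4] at h1
  rw [h2, h3] at h1
  rw [h1]
  refine exists_lintegral_le ?_
  rw [← h1]
  exact ENNReal.mul_ne_top (measure_ne_top _ _) ENNReal.ofReal_ne_top

/-- A ball of radius `r / 2` with its share of `S` lies in the ball of radius `r` about each of its
points. The powers of `r` cancel, so the loss is purely dimensional. -/
lemma exists_ball_segments {d : ℕ} {S : Set (Torus d)} (hS : MeasurableSet S) {r : ℝ}
    (hr0 : 0 < r) (hr : r ≤ 1 / 2) :
    ∃ y : Torus d, ∀ x₀ ∈ Metric.closedBall y (r / 2), ∃ v : Fin d → ℝ, ‖v‖ ≤ 2 * r ∧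
      volume S ≤ 2 * 4 ^ d * volume {s ∈ Icc (0 : ℝ) 1 | x₀ + proj (s • v) ∈ S} := by
  obtain ⟨y, hy⟩ := exists_ball_inter_ge hS (r := r / 2) (by positivity) (by linarith)
  refine ⟨y, fun x₀ hx₀ => ?_⟩
  obtain ⟨v, hv, hvol⟩ := exists_segment x₀ hr0 hS
  refine ⟨v, hv, ?_⟩
  have hsub : S ∩ Metric.closedBall y (r / 2) ⊆ S ∩ Metric.closedBall x₀ r := by
    refine inter_subset_inter_right _ (Metric.closedBall_subset_closedBall' ?_)
    rw [Metric.mem_closedBall'] at hx₀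
    linarith
  have h1 := (hy.trans (measure_mono hsub)).trans hvol
  rw [show 2 * (r / 2) = r by ring, mul_pow, ENNReal.ofReal_mul (by positivity)] at h1
  have hr0' : ENNReal.ofReal (r ^ d) ≠ 0 := by
    rw [Ne, ENNReal.ofReal_eq_zero, not_le]; positivity
  rw [← ENNReal.mul_le_mul_iff_left hr0' ENNReal.ofReal_ne_top]
  refine h1.trans (le_of_eq ?_)
  rw [ENNReal.ofReal_pow (by norm_num), ENNReal.ofReal_ofNat]
  ring

/-- In the sup norm the closed ball of radius `1 / 2` is the whole torus, so no choice of ball is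
needed. -/
lemma exists_long_segment {d : ℕ} {S : Set (Torus d)} (hS : MeasurableSet S) (x₀ : Torus d) :
    ∃ v : Fin d → ℝ, ‖v‖ ≤ 1 ∧
      volume S ≤ 2 * 4 ^ d * volume {s ∈ Icc (0 : ℝ) 1 | x₀ + proj (s • v) ∈ S} := by
  obtain ⟨v, hv, hvol⟩ := exists_segment x₀ (r := 1 / 2) (by norm_num) hS
  refine ⟨v, by linarith, ?_⟩
  have huniv : Metric.closedBall x₀ (1 / 2) = univ := by
    rw [eq_univ_iff_forall]
    intro x
    rw [Metric.mem_closedBall, dist_eq_norm]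
    refine (pi_norm_le_iff_of_nonneg (by norm_num)).2 fun i => ?_
    simpa using AddCircle.norm_le_half_period (1 : ℝ) (x := (x - x₀) i) one_ne_zero
  rw [huniv, inter_univ] at hvol
  refine hvol.trans ?_
  gcongr
  rw [← ENNReal.ofReal_ofNat 4, ← ENNReal.ofReal_pow (by norm_num)]
  apply ENNReal.ofReal_le_ofReal
  gcongr
  norm_num

/-- Quantitative Poincaré recurrence. -/
lemma exists_return {α : Type*} [MeasurableSpace α] {μ : Measure α} [IsProbabilityMeasure μ]
    {T : α → α} (hT : MeasurePreserving T μ μ) {G : Set α} (hG : MeasurableSet G) {g : ℝ}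
    (hg : 0 < g) (hgG : ENNReal.ofReal g ≤ μ G) {K : ℕ} (hK : 2 ≤ K * g) :
    ∃ n : ℕ, 0 < n ∧ n < K ∧ ENNReal.ofReal (g / (2 * K)) ≤ μ (G ∩ T^[n] ⁻¹' G) := by
  by_contra! hcon
  have hKpos : (0 : ℝ) < K := by
    by_contra h
    nlinarith
  have hKn : 1 ≤ K := by exact_mod_cast hKpos
  -- If all return sets were small, `G \ R` would keep measure above `g / 2 ≥ 1 / K`; by pigeonhole
  -- one of its points would return before time `K` and so lie in `R`.
  set R : Set α := ⋃ n ∈ Finset.Ioo 0 K, G ∩ T^[n] ⁻¹' G with hR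
  have hRm : MeasurableSet R :=
    Finset.measurableSet_biUnion _ fun n _ => hG.inter ((hT.iterate n).measurable hG)
  have hRμ : μ R ≤ ENNReal.ofReal ((K - 1) * (g / (2 * K))) := by
    calc μ R ≤ ∑ n ∈ Finset.Ioo 0 K, μ (G ∩ T^[n] ⁻¹' G) := measure_biUnion_finset_le _ _
      _ ≤ ∑ n ∈ Finset.Ioo 0 K, ENNReal.ofReal (g / (2 * K)) := by
          refine Finset.sum_le_sum fun n hn => ?_
          rw [Finset.mem_Ioo] at hn
          exact (hcon n hn.1 hn.2).le
      _ = ENNReal.ofReal ((K - 1) * (g / (2 * K))) := by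
          rw [Finset.sum_const, Nat.card_Ioo, nsmul_eq_mul,
            ENNReal.ofReal_mul (by
              have : (1 : ℝ) ≤ K := by exact_mod_cast hKn
              linarith)]
          congr 1
          rw [show ((K : ℝ) - 1) = ((K - 0 - 1 : ℕ) : ℝ) by
            rw [Nat.sub_zero, Nat.cast_sub hKn]; simp, ENNReal.ofReal_natCast]
  have hdiff : ENNReal.ofReal (g / 2) < μ (G \ R) := by
    refine lt_of_lt_of_le ?_ (le_measure_sdiff (μ := μ) (s₁ := G) (s₂ := R))
    refine lt_of_lt_of_le ?_ (tsub_le_tsub hgG hRμ)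
    rw [← ENNReal.ofReal_sub _ (by
      have : (1 : ℝ) ≤ K := by exact_mod_cast hKn
      have : 0 ≤ (K : ℝ) - 1 := by linarith
      positivity)]
    rw [ENNReal.ofReal_lt_ofReal_iff_of_nonneg (by positivity)]
    have : ((K : ℝ) - 1) * (g / (2 * K)) = g / 2 - g / (2 * K) := by field_simp
    rw [this]
    have : 0 < g / (2 * K) := by positivity
    linarith
  have hlt : μ univ < K * μ (G \ R) := by
    rw [measure_univ]
    calc (1 : ENNReal) ≤ ENNReal.ofReal (K * (g / 2)) := by
          rw [ENNReal.one_le_ofReal]; linarith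
      _ = K * ENNReal.ofReal (g / 2) := by
          rw [ENNReal.ofReal_mul hKpos.le, ENNReal.ofReal_natCast]
      _ < _ := by
          refine (ENNReal.mul_lt_mul_iff_right ?_ (ENNReal.natCast_ne_top K)).2 hdiff
          exact_mod_cast hKpos.ne'
  obtain ⟨x, hx, m, hm, hmx⟩ := hT.exists_mem_iterate_mem_of_measure_univ_lt_mul_measure
    (hG.diff hRm).nullMeasurableSet hlt
  apply hx.2
  simp only [hR, mem_iUnion]
  exact ⟨m, by simpa using hm, hx.1, hmx.1⟩

end Measure

/-! ### Holomorphic extension along lines -/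

section LineExtension

open Set

/-- Along every line with direction of norm at most one, `f` extends to a holomorphic function on
the strip `|Im z| < 2 h`, bounded by `M`. -/
def LineExtends {d : ℕ} (h M : ℝ) (f : Torus d → ℝ) : Prop :=
  ∀ (x : Torus d) (v : Fin d → ℝ), ‖v‖ ≤ 1 → ∃ φ : ℂ → ℂ,
    DifferentiableOn ℂ φ {z | |z.im| < 2 * h} ∧ (∀ z : ℂ, |z.im| < 2 * h → ‖φ z‖ ≤ M) ∧
      ∀ s : ℝ, φ s = (f (x + proj (s • v)) : ℂ)

lemma norm_e_apply {d : ℕ} (x : Torus d) (i : Fin d) : ‖e x i‖ = 1 := Circle.norm_coe _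

lemma e_mem_annuli {d : ℕ} {ρ : ℝ} (hρ : 0 < ρ) (x : Torus d) : e x ∈ annuli d ρ := by
  intro i
  rw [norm_e_apply]
  constructor <;> linarith

lemma continuous_e {d : ℕ} : Continuous (e : Torus d → Fin d → ℂ) := by
  refine continuous_pi fun i => ?_
  exact continuous_subtype_val.comp (AddCircle.continuous_toCircle.comp (continuous_apply i))

lemma e_add_proj {d : ℕ} (x : Torus d) (u : Fin d → ℝ) (i : Fin d) :
    e (x + proj u) i = e x i * Complex.exp (2 * Real.pi * Complex.I * (u i : ℂ)) := by
  simp only [e, proj, Pi.add_apply]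
  rw [AddCircle.toCircle_add, Circle.coe_mul, AddCircle.toCircle_apply_mk, Circle.coe_exp]
  congr 2
  push_cast
  ring

lemma LineExtends.abs_le {d : ℕ} {h M : ℝ} (hh : 0 < h) {f : Torus d → ℝ}
    (hf : LineExtends h M f) (x : Torus d) : |f x| ≤ M := by
  obtain ⟨φ, -, hφM, hφ⟩ := hf x 0 (by simp)
  have h0 := hφ 0
  have h1 := hφM ((0 : ℝ) : ℂ) (by simp [hh])
  rw [h0, Complex.norm_real] at h1
  have : proj (0 : Fin d → ℝ) = 0 := by funext i; simp [proj]
  simpa [this] using h1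

/-- Lipschitz estimate for functions with holomorphic extensions. -/
lemma LineExtends.abs_sub_le {d : ℕ} {h M : ℝ} (hh : 0 < h) {f : Torus d → ℝ}
    (hf : LineExtends h M f) {x y : Torus d} (hxy : dist y x < h) :
    |f y - f x| ≤ 2 * M / h * dist y x := by
  obtain ⟨u, hu, hun⟩ := exists_proj_eq (y - x)
  rw [← dist_eq_norm] at hun
  obtain ⟨φ, hφd, hφM, hφ⟩ := hf x (‖u‖⁻¹ • u) (by
    rw [norm_smul, norm_inv, norm_norm]
    exact inv_mul_le_one)
  have hball : ∀ z ∈ Metric.ball (0 : ℂ) h, |z.im| < 2 * h := by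
    intro z hz
    rw [mem_ball_zero_iff] at hz
    linarith [Complex.abs_im_le_norm z]
  have hmaps : MapsTo φ (Metric.ball 0 h) (Metric.closedBall (φ 0) (2 * M)) := by
    intro z hz
    rw [Metric.mem_closedBall, dist_eq_norm]
    have h1 := hφM z (hball z hz)
    have h2 := hφM 0 (by simp [hh])
    linarith [norm_sub_le (φ z) (φ 0)]
  have hz : ((‖u‖ : ℝ) : ℂ) ∈ Metric.ball (0 : ℂ) h := by
    rw [mem_ball_zero_iff, Complex.norm_real, norm_norm, hun]
    exact hxy
  -- Schwarz lemma on the disk of radius `h`, along the unit direction from `x` to `y`.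
  have key := Complex.dist_le_div_mul_dist_of_mapsTo_ball
    (hφd.mono fun z hz => hball z hz) hmaps hz
  rw [dist_zero_right, Complex.norm_real, norm_norm, hun, dist_eq_norm, hφ, ← Complex.ofReal_zero,
    hφ] at key
  have h1 : ‖u‖ • ‖u‖⁻¹ • u = u := by
    by_cases h0 : u = 0
    · simp [h0]
    · rw [smul_smul, mul_inv_cancel₀ (norm_ne_zero_iff.2 h0), one_smul]
  have h2 : proj ((0 : ℝ) • ‖u‖⁻¹ • u) = 0 := by funext i; simp [proj]
  rw [← hun, h1, hu, h2, add_zero, add_sub_cancel, ← Complex.ofReal_sub,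
    Complex.norm_real, hun] at key
  exact key

lemma UniformlyAnalytic.exists_lineExtends {d : ℕ} {T : Torus d → Torus d} {V : Torus d → ℝ}
    (h : UniformlyAnalytic T V) :
    ∃ ρ > 0, ∃ K : ℝ, 0 ≤ K ∧ (∀ n : ℕ, LineExtends ρ K fun x => V (T^[n] x)) := by
  obtain ⟨ρ, hρ, K, hF⟩ := h
  choose F hFa hFK hFV using hF
  have hK : 0 ≤ K := (norm_nonneg _).trans (hFK 0 _ (e_mem_annuli hρ (0 : Torus d)))
  -- Chosen so that `|Im z| < 2 h₀` changes each modulus by a factor strictly between `1 / (1 + ρ)`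
  -- and `1 + ρ`; the former exceeds `1 - ρ`.
  set h₀ : ℝ := Real.log (1 + ρ) / (2 * (2 * Real.pi)) with hh₀
  have hlog : 0 < Real.log (1 + ρ) := Real.log_pos (by linarith)
  have hpi := Real.pi_pos
  refine ⟨h₀, by positivity, K, hK, fun n x v hv => ?_⟩
  set Z : ℂ → Fin d → ℂ := fun z i => e x i * Complex.exp (2 * Real.pi * Complex.I * (v i * z))
    with hZ
  have hZmem : ∀ z : ℂ, |z.im| < 2 * h₀ → Z z ∈ annuli d ρ := by
    intro z hz i
    have hn : ‖Z z i‖ = Real.exp (-(2 * Real.pi * (v i * z.im))) := by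
      simp [hZ, norm_e_apply, Complex.norm_exp]
    have hvi : |v i| ≤ 1 := (norm_le_pi_norm v i).trans hv
    have hb : |2 * Real.pi * (v i * z.im)| < Real.log (1 + ρ) := by
      rw [abs_mul (2 * Real.pi), abs_mul (v i), abs_of_pos (by positivity : 0 < 2 * Real.pi)]
      calc 2 * Real.pi * (|v i| * |z.im|) ≤ 2 * Real.pi * (1 * |z.im|) := by gcongr
        _ < 2 * Real.pi * (1 * (2 * h₀)) := by gcongr
        _ = _ := by rw [hh₀]; field_simp
    obtain ⟨hb1, hb2⟩ := abs_lt.1 hb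
    rw [hn]
    constructor
    · calc 1 - ρ < (1 + ρ)⁻¹ := by
            rw [← one_div, lt_div_iff₀ (by linarith)]
            nlinarith
        _ = Real.exp (-Real.log (1 + ρ)) := by rw [Real.exp_neg, Real.exp_log (by linarith)]
        _ < _ := Real.exp_lt_exp.2 (by linarith)
    · calc _ < Real.exp (Real.log (1 + ρ)) := Real.exp_lt_exp.2 (by linarith)
        _ = _ := Real.exp_log (by linarith)
  refine ⟨fun z => F n (Z z), ?_, fun z hz => hFK n _ (hZmem z hz), fun s => ?_⟩
  · refine (hFa n).differentiableOn.comp ?_ hZmem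
    refine Differentiable.differentiableOn ?_
    rw [differentiable_pi]
    intro i
    simp only [hZ]
    fun_prop
  · change F n (Z s) = _
    rw [← hFV]
    congr 1
    funext i
    rw [e_add_proj]
    simp only [hZ, Pi.smul_apply, smul_eq_mul]
    push_cast
    ring_nf

lemma UniformlyAnalytic.continuous {d : ℕ} {T : Torus d → Torus d} {V : Torus d → ℝ}
    (h : UniformlyAnalytic T V) : Continuous V := by
  obtain ⟨ρ, hρ, K, hF⟩ := h
  obtain ⟨F, hFa, -, hFV⟩ := hF 0
  have h1 : Continuous fun x : Torus d => F (e x) :=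
    hFa.continuousOn.comp_continuous continuous_e (e_mem_annuli hρ)
  have h2 : V = fun x => (F (e x)).re := by
    funext x; rw [hFV]; simp
  rw [h2]
  exact Complex.continuous_re.comp h1

variable {d : ℕ} {T : Torus d → Torus d} {V : Torus d → ℝ} {E : ℝ}

lemma measurable_monodromy (hT : Measurable T) (hV : Measurable V) (n : ℕ) (i j : Fin 2) :
    Measurable fun x => monodromy T V E n x i j := by
  induction n generalizing i with
  | zero => simp [monodromy]
  | succ n ih =>
    have hVn : Measurable fun x => V (T^[n + 1] x) := hV.comp (hT.iterate (n + 1))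
    fin_cases i
    · simp only [Fin.zero_eta, monodromy_succ_apply_zero]
      exact ((hVn.sub_const E).mul (ih 0)).sub (ih 1)
    · simp only [Fin.mk_one, monodromy_succ_apply_one]
      exact ih 0

lemma abs_monodromy_le {K B : ℝ} (hV : ∀ x, |V x| ≤ K) (hB : K + |E| + 1 ≤ B) (n : ℕ)
    (x : Torus d) (i j : Fin 2) : |monodromy T V E n x i j| ≤ B ^ n := by
  have hK : 0 ≤ K := (abs_nonneg _).trans (hV x)
  have hB1 : 1 ≤ B := by linarith [abs_nonneg E]
  induction n generalizing i with
  | zero =>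
    simp only [monodromy, Matrix.one_apply, pow_zero]
    split_ifs <;> simp
  | succ n ih =>
    fin_cases i
    · simp only [Fin.zero_eta, monodromy_succ_apply_zero]
      calc _ ≤ (|V (T^[n + 1] x)| + |E|) * |monodromy T V E n x 0 j| +
              |monodromy T V E n x 1 j| := by
            refine (abs_sub _ _).trans ?_
            rw [abs_mul]
            gcongr
            exact abs_sub _ _
        _ ≤ (K + |E|) * B ^ n + B ^ n := by
            gcongr
            · exact hV _
            · exact ih 0
            · exact ih 1
        _ = (K + |E| + 1) * B ^ n := by ring
        _ ≤ B * B ^ n := by gcongr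
        _ = _ := by ring
    · simp only [Fin.mk_one, monodromy_succ_apply_one]
      exact (ih 0).trans (pow_le_pow_right₀ hB1 (by omega))

lemma lineExtends_monodromy {h K B : ℝ} (hK : 0 ≤ K)
    (hV : ∀ n : ℕ, LineExtends h K fun x => V (T^[n] x)) (hB : K + |E| + 1 ≤ B) (n : ℕ) :
    LineExtends h (B ^ n) fun x => monodromy T V E n x 0 0 := by
  have hB1 : 1 ≤ B := by linarith [abs_nonneg E]
  intro x v hv
  -- The recursion couples the two entries of the first column, so the induction carries both.
  suffices hmain : ∃ φ ψ : ℂ → ℂ,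
      (DifferentiableOn ℂ φ {z | |z.im| < 2 * h} ∧ (∀ z : ℂ, |z.im| < 2 * h → ‖φ z‖ ≤ B ^ n) ∧
        ∀ s : ℝ, φ s = (monodromy T V E n (x + proj (s • v)) 0 0 : ℂ)) ∧
      (DifferentiableOn ℂ ψ {z | |z.im| < 2 * h} ∧ (∀ z : ℂ, |z.im| < 2 * h → ‖ψ z‖ ≤ B ^ n) ∧
        ∀ s : ℝ, ψ s = (monodromy T V E n (x + proj (s • v)) 1 0 : ℂ)) by
    obtain ⟨φ, -, hφ, -⟩ := hmain
    exact ⟨φ, hφ⟩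
  induction n with
  | zero =>
    refine ⟨fun _ => 1, fun _ => 0, ⟨by fun_prop, by simp, by simp [monodromy]⟩,
      ⟨by fun_prop, by simp, by simp [monodromy]⟩⟩
  | succ n ih =>
    obtain ⟨φ, ψ, ⟨hφd, hφb, hφ⟩, ⟨hψd, hψb, hψ⟩⟩ := ih
    obtain ⟨w, hwd, hwb, hw⟩ := hV (n + 1) x v hv
    refine ⟨fun z => (w z - E) * φ z - ψ z, φ, ⟨?_, ?_, ?_⟩, ⟨hφd, ?_, ?_⟩⟩
    · exact ((hwd.sub_const _).mul hφd).sub hψd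
    · intro z hz
      calc ‖(w z - E) * φ z - ψ z‖ ≤ (‖w z‖ + ‖(E : ℂ)‖) * ‖φ z‖ + ‖ψ z‖ := by
            refine (norm_sub_le _ _).trans ?_
            rw [norm_mul]
            gcongr
            exact norm_sub_le _ _
        _ ≤ (K + |E|) * B ^ n + B ^ n := by
            gcongr
            · exact hwb z hz
            · rw [Complex.norm_real, Real.norm_eq_abs]
            · exact hφb z hz
            · exact hψb z hz
        _ = (K + |E| + 1) * B ^ n := by ring
        _ ≤ B * B ^ n := by gcongr
        _ = _ := by ring
    · intro s
      change (w s - E) * φ s - ψ s = _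
      rw [hw, hφ, hψ, monodromy_succ_apply_zero]
      push_cast
      ring
    · intro z hz
      exact (hφb z hz).trans (pow_le_pow_right₀ hB1 (by omega))
    · intro s
      rw [hφ, monodromy_succ_apply_one]

end LineExtension

/-! ### Comparison of scales for large `N` -/

section Asymptotics

open Filter Set

lemma eventually_mul_rpow_le {a b : ℝ} (hab : a < b) (c : ℝ) :
    ∀ᶠ N : ℕ in atTop, c * (N : ℝ) ^ a ≤ (N : ℝ) ^ b := by
  have h1 : Tendsto (fun N : ℕ => (N : ℝ) ^ (b - a)) atTop atTop :=
    (tendsto_rpow_atTop (by linarith)).comp tendsto_natCast_atTop_atTop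
  filter_upwards [h1.eventually_ge_atTop c, eventually_gt_atTop 0] with N hN hN0
  have hN0' : (0 : ℝ) < N := by exact_mod_cast hN0
  calc c * (N : ℝ) ^ a ≤ (N : ℝ) ^ (b - a) * (N : ℝ) ^ a := by gcongr
    _ = (N : ℝ) ^ b := by rw [← Real.rpow_add hN0']; congr 1; ring

lemma eventually_le_rpow {b : ℝ} (hb : 0 < b) (c : ℝ) :
    ∀ᶠ N : ℕ in atTop, c ≤ (N : ℝ) ^ b := by
  filter_upwards [eventually_mul_rpow_le hb c] with N hN
  simpa using hN

lemma eventually_log_le_rpow {b : ℝ} (hb : 0 < b) (c : ℝ) :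
    ∀ᶠ N : ℕ in atTop, c * Real.log N ≤ (N : ℝ) ^ b := by
  have h := (isLittleO_log_rpow_atTop (half_pos hb)).bound one_pos
  filter_upwards [tendsto_natCast_atTop_atTop.eventually h,
    eventually_mul_rpow_le (half_lt_self hb) |c|] with N h1 h2
  rw [one_mul, Real.norm_eq_abs, Real.norm_eq_abs,
    abs_of_nonneg (by positivity : 0 ≤ (N : ℝ) ^ (b / 2))] at h1
  calc c * Real.log N ≤ |c| * |Real.log N| := by rw [← abs_mul]; exact le_abs_self _
    _ ≤ |c| * (N : ℝ) ^ (b / 2) := by gcongr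
    _ ≤ _ := h2

lemma eventually_mul_exp_le {a b : ℝ} (hab : a < b) (hb : 0 < b) (c C : ℝ) {ε : ℝ} (hε : 0 < ε) :
    ∀ᶠ N : ℕ in atTop, C * Real.exp (c * (N : ℝ) ^ a - (N : ℝ) ^ b) ≤ ε := by
  filter_upwards [eventually_mul_rpow_le hab (2 * c),
    eventually_le_rpow hb (2 * Real.log ((|C| + 1) / ε))] with N h1 h2
  have hC : (0 : ℝ) < (|C| + 1) / ε := by positivity
  calc C * Real.exp (c * (N : ℝ) ^ a - (N : ℝ) ^ b)
      ≤ (|C| + 1) * Real.exp (-Real.log ((|C| + 1) / ε)) := by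
        gcongr
        · linarith [le_abs_self C]
        · linarith
    _ = ε := by rw [Real.exp_neg, Real.exp_log hC]; field_simp

/-- Asymptotic form of the Remez-type inequality. -/
lemma eventually_strip_remez {h : ℝ} (hh : 0 < h) {α β γ : ℝ} (hα : 0 < α) (hβ : 0 < β)
    (hγ : α + β < γ) :
    ∀ᶠ N : ℕ in atTop, ∀ (φ : ℂ → ℂ) (S : Set ℝ),
      DifferentiableOn ℂ φ {z | |z.im| < 2 * h} →
      (∀ z : ℂ, |z.im| ≤ h → ‖φ z‖ ≤ Real.exp ((N : ℝ) ^ β)) →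
      S ⊆ Icc 0 1 → ENNReal.ofReal (Real.exp (-(N : ℝ) ^ α)) ≤ volume S →
      (∀ y ∈ S, ‖φ (y : ℝ)‖ ≤ Real.exp (-(N : ℝ) ^ γ)) →
      ∀ x : ℝ, x ∈ Icc (0 : ℝ) 1 → ‖φ x‖ ≤ Real.exp (-(N : ℝ) ^ β) := by
  set c : ℝ := Real.pi / (4 * h) with hc
  have hcpos : 0 < c := by positivity
  set q : ℝ := Real.tanh c with hq
  have hq0 : 0 < q := by
    rw [hq, Real.tanh_eq_sinh_div_cosh]
    exact div_pos (Real.sinh_pos_iff.2 hcpos) (Real.cosh_pos c)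
  have hq1 : q < 1 := Real.tanh_lt_one c
  have hlogq : Real.log q < 0 := Real.log_neg hq0 hq1
  -- With about `c₀ N^β` nodes, `q^k` is at most `exp (-3 N^β)` and beats the bound `exp (N^β)`. The
  -- price of the divisions is `exp (O(N^(α+β)))`, absorbed because `α + β < γ`.
  set c₀ : ℝ := 3 / (-Real.log q) with hc₀
  have hc₀pos : 0 < c₀ := by apply div_pos (by norm_num); linarith
  set D : ℝ := 4 * Real.cosh c / c with hD
  have hDpos : 0 < D := by have := Real.cosh_pos c; positivity
  filter_upwards [eventually_ge_atTop 1, eventually_le_rpow hα (2 * Real.log ((D + 2) * (c₀ + 1))),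
    eventually_log_le_rpow hα (2 * β), eventually_mul_rpow_le hγ (4 * (c₀ + 1)),
    eventually_mul_rpow_le (show β < γ by linarith) 4]
    with N hN1 hlog1 hlog2 hexp hexp2 φ S hd hM hS01 hS hSε x hx
  have hN1' : (1 : ℝ) ≤ N := by exact_mod_cast hN1
  have hN0' : (0 : ℝ) < N := by linarith
  have hNβ : 1 ≤ (N : ℝ) ^ β := Real.one_le_rpow hN1' hβ.le
  set k : ℕ := ⌈c₀ * (N : ℝ) ^ β⌉₊ with hk
  have hkpos : 0 < k := Nat.ceil_pos.2 (by positivity)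
  have hk1 : (1 : ℝ) ≤ k := by exact_mod_cast hkpos
  have hklow : c₀ * (N : ℝ) ^ β ≤ k := Nat.le_ceil _
  have hkup : (k : ℝ) ≤ (c₀ + 1) * (N : ℝ) ^ β := by
    have := (Nat.ceil_lt_add_one (show 0 ≤ c₀ * (N : ℝ) ^ β by positivity)).le
    rw [← hk] at this
    linarith
  have key := strip_remez hh hd hM (Real.exp_pos _).le (Real.exp_pos _) hS01 hS hSε hkpos hx
  rw [← hc, ← hq, ← hD] at key
  have hA : q ^ k * Real.exp ((N : ℝ) ^ β) ≤ Real.exp (-2 * (N : ℝ) ^ β) := by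
    rw [← Real.exp_log hq0, ← Real.exp_nat_mul, ← Real.exp_add]
    apply Real.exp_le_exp.2
    have h1 : k * Real.log q ≤ c₀ * (N : ℝ) ^ β * Real.log q :=
      mul_le_mul_of_nonpos_right hklow hlogq.le
    have h2 : c₀ * (N : ℝ) ^ β * Real.log q = -3 * (N : ℝ) ^ β := by
      have := hlogq.ne
      rw [hc₀]
      field_simp
    linarith
  have hB : Real.exp (-(N : ℝ) ^ γ) * (D * k / Real.exp (-(N : ℝ) ^ α) + 2) ^ k ≤
      Real.exp (-2 * (N : ℝ) ^ β) := by
    have h1 : D * k / Real.exp (-(N : ℝ) ^ α) + 2 ≤ Real.exp (2 * (N : ℝ) ^ α) := by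
      rw [Real.exp_neg, div_inv_eq_mul]
      have he : 1 ≤ Real.exp ((N : ℝ) ^ α) := Real.one_le_exp (by positivity)
      calc D * k * Real.exp ((N : ℝ) ^ α) + 2 ≤ (D + 2) * k * Real.exp ((N : ℝ) ^ α) := by
            have : 1 ≤ k * Real.exp ((N : ℝ) ^ α) := one_le_mul_of_one_le_of_one_le hk1 he
            nlinarith
        _ ≤ (D + 2) * ((c₀ + 1) * (N : ℝ) ^ β) * Real.exp ((N : ℝ) ^ α) := by gcongr
        _ = Real.exp (Real.log ((D + 2) * (c₀ + 1)) + β * Real.log N) * Real.exp ((N : ℝ) ^ α) := by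
            rw [Real.exp_add, Real.exp_log (by positivity), Real.rpow_def_of_pos hN0',
              mul_comm β]
            ring
        _ ≤ Real.exp ((N : ℝ) ^ α) * Real.exp ((N : ℝ) ^ α) := by
            gcongr
            linarith
        _ = _ := by rw [← Real.exp_add]; congr 1; ring
    calc _ ≤ Real.exp (-(N : ℝ) ^ γ) * Real.exp (2 * (N : ℝ) ^ α) ^ k := by gcongr
      _ = Real.exp (-(N : ℝ) ^ γ + k * (2 * (N : ℝ) ^ α)) := by
          rw [← Real.exp_nat_mul, ← Real.exp_add]
      _ ≤ _ := by
          apply Real.exp_le_exp.2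
          have h2 : k * (2 * (N : ℝ) ^ α) ≤ (c₀ + 1) * (N : ℝ) ^ β * (2 * (N : ℝ) ^ α) := by
            gcongr
          have h3 : (c₀ + 1) * (N : ℝ) ^ β * (2 * (N : ℝ) ^ α) =
              2 * (c₀ + 1) * (N : ℝ) ^ (α + β) := by
            rw [Real.rpow_add hN0']; ring
          linarith
  calc ‖φ x‖ ≤ _ := key
    _ ≤ Real.exp (-2 * (N : ℝ) ^ β) + Real.exp (-2 * (N : ℝ) ^ β) := add_le_add hA hB
    _ = 2 * Real.exp (-(N : ℝ) ^ β) * Real.exp (-(N : ℝ) ^ β) := by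
        rw [mul_assoc, ← Real.exp_add]; ring_nf
    _ ≤ 1 * Real.exp (-(N : ℝ) ^ β) := by
        gcongr
        have h1 : Real.exp (-(N : ℝ) ^ β) ≤ Real.exp (-1) := Real.exp_le_exp.2 (by linarith)
        have h2 := Real.exp_neg_one_lt_half
        linarith
    _ = _ := one_mul _

end Asymptotics

/-! ### Algebraic consequences of small entries -/

section Cocycle

open Set

variable {d : ℕ} {T : Torus d → Torus d} {V : Torus d → ℝ} {E : ℝ}

/-- The operator norm of the monodromy matrix. -/
noncomputable def monodromyNorm (T : Torus d → Torus d) (V : Torus d → ℝ) (E : ℝ) (n : ℕ)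
    (x : Torus d) : ℝ :=
  ‖Matrix.toEuclideanCLM (n := Fin 2) (𝕜 := ℝ) (monodromy T V E n x)‖

lemma logNorm_eq (n : ℕ) (x : Torus d) :
    logNorm T V E n x = Real.log (monodromyNorm T V E n x) := rfl

lemma abs_monodromy_le_norm (n : ℕ) (x : Torus d) (i j : Fin 2) :
    |monodromy T V E n x i j| ≤ monodromyNorm T V E n x := abs_apply_le_opNorm _ i j

lemma monodromyNorm_le_two_mul {n : ℕ} {x : Torus d} {a : ℝ}
    (h : ∀ i j, |monodromy T V E n x i j| ≤ a) : monodromyNorm T V E n x ≤ 2 * a := by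
  rw [two_mul]
  exact opNorm_le_max_add _ a a (h 0 0) (h 1 1) (h 0 1) (h 1 0)

lemma monodromyNorm_pos (n : ℕ) (x : Torus d) : 0 < monodromyNorm T V E n x := by
  by_contra hcon
  have h : ∀ i j, monodromy T V E n x i j = 0 := fun i j =>
    abs_nonpos_iff.1 ((abs_monodromy_le_norm n x i j).trans (not_lt.1 hcon))
  have := det_monodromy T V E n x
  rw [Matrix.det_fin_two, h 0 0, h 0 1] at this
  simp at this

/-- Integrability is not needed: a non-integrable function has integral `0` by default, which `0 ≤
b` covers. -/
lemma finiteLyapunov_le {n : ℕ} (hn : 1 ≤ n) {b : ℝ} (hb : 0 ≤ b)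
    (h : ∀ x, logNorm T V E n x ≤ b) : finiteLyapunov T V E n ≤ b := by
  have hle : ∫ x : Torus d, logNorm T V E n x ≤ b := by
    by_cases hi : Integrable (fun x : Torus d => logNorm T V E n x)
    · calc _ ≤ ∫ _ : Torus d, b := integral_mono hi (integrable_const b) h
        _ = b := by simp
    · rw [integral_undef hi]; exact hb
  have hn' : (1 : ℝ) ≤ n := by exact_mod_cast hn
  rw [finiteLyapunov, one_div, inv_mul_le_iff₀ (by linarith)]
  nlinarith

lemma lt_finiteLyapunov {γ : ℝ} (hγ : 0 < γ) (h : γ < lyapunov T V E) {n : ℕ} (hn : 1 ≤ n) :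
    γ < finiteLyapunov T V E n := by
  have hbdd : BddBelow (range fun n : ℕ => finiteLyapunov T V E (n + 1)) := by
    by_contra hcon
    -- An infimum unbounded below is `0` by default, which `γ > 0` excludes.
    rw [lyapunov, Real.iInf_of_not_bddBelow hcon] at h
    linarith
  obtain ⟨m, rfl⟩ : ∃ m, n = m + 1 := ⟨n - 1, by omega⟩
  exact h.trans_le (ciInf_le hbdd m)

/-- Far from the range of the potential the `(0,0)` entry dominates the monodromy matrix. -/
lemma abs_monodromy_le_of_large_energy (hE : ∀ x, 3 ≤ |V x - E|) (n : ℕ) (x : Torus d)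
    (i j : Fin 2) : |monodromy T V E n x i j| ≤ |monodromy T V E n x 0 0| := by
  have h3 : ∀ w a b : ℝ, 3 ≤ |w| → |b| ≤ |a| → |a| ≤ |w * a - b| := by
    intro w a b hw hb
    have h1 := abs_sub_abs_le_abs_sub (w * a) b
    rw [abs_mul] at h1
    nlinarith [abs_nonneg a]
  have h10 : ∀ n x, |monodromy T V E n x 1 0| ≤ |monodromy T V E n x 0 0| := by
    intro n x
    induction n with
    | zero => simp [monodromy]
    | succ n ih =>
      rw [monodromy_succ_apply_one, monodromy_succ_apply_zero]
      exact h3 _ _ _ (hE _) ih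
  have h01 : ∀ n x, |monodromy T V E n x 0 1| ≤ |monodromy T V E n x 0 0| := by
    intro n
    induction n with
    | zero => simp [monodromy]
    | succ n ih =>
      intro x
      rw [monodromy_apply_right_one, monodromy_apply_right_zero, abs_neg, ← sub_neg_eq_add]
      exact h3 _ _ _ (hE _) (by rw [abs_neg]; exact ih _)
  have h11 : |monodromy T V E n x 1 1| ≤ |monodromy T V E n x 0 0| := by
    cases n with
    | zero => simp [monodromy]
    | succ n =>
      rw [monodromy_succ_apply_one, monodromy_succ_apply_zero]
      exact (h01 n x).trans (h3 _ _ _ (hE _) (h10 n x))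
  fin_cases i <;> fin_cases j
  · exact le_rfl
  · exact h01 n x
  · exact h10 n x
  · exact h11

/-- If the `(0,0)` entry is much smaller than the norm, then so is one of its neighbours. -/
lemma small_column_or_row {M : Matrix (Fin 2) (Fin 2) ℝ} (hdet : M.det = 1) {P m : ℝ}
    (hm : 4 ≤ m) (hP : 3 * m / 4 ≤ 2 * P) (h00 : |M 0 0| ≤ Real.exp (P - m))
    (h11 : |M 1 1| ≤ Real.exp (P + m / 4)) :
    |M 1 0| ≤ Real.exp (P - m / 4) ∨ |M 0 1| ≤ Real.exp (P - m / 4) := by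
  by_contra! hcon
  rw [Matrix.det_fin_two] at hdet
  -- The determinant bounds the product of the off-diagonal entries, so they cannot both be large.
  have h1 : |M 0 1| * |M 1 0| ≤ 1 + |M 0 0| * |M 1 1| := by
    rw [← abs_mul, ← abs_mul]
    have : M 0 1 * M 1 0 = M 0 0 * M 1 1 - 1 := by linarith
    rw [this]
    refine (abs_sub _ _).trans ?_
    rw [abs_one]; linarith
  have h2 : |M 0 0| * |M 1 1| ≤ Real.exp (2 * P - 3 * m / 4) := by
    calc _ ≤ Real.exp (P - m) * Real.exp (P + m / 4) := by gcongr
      _ = _ := by rw [← Real.exp_add]; congr 1; ring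
  have h3 : 1 ≤ Real.exp (2 * P - 3 * m / 4) := Real.one_le_exp (by linarith)
  have h4 : Real.exp (P - m / 4) * Real.exp (P - m / 4) < |M 0 1| * |M 1 0| := by
    exact mul_lt_mul'' hcon.2 hcon.1 (Real.exp_pos _).le (Real.exp_pos _).le
  have h5 : Real.exp (P - m / 4) * Real.exp (P - m / 4) =
      Real.exp (2 * P - 3 * m / 4) * Real.exp (m / 4) := by
    rw [← Real.exp_add, ← Real.exp_add]; congr 1; ring
  have h6 : 2 ≤ Real.exp (m / 4) := by
    have := Real.add_one_le_exp (m / 4)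
    linarith
  nlinarith

lemma abs_mul_le_of_add_eq {a Q p q r s t u v w : ℝ}
    (h : p * q + r * s = t * u + v * w) (hp : |p| ≤ a) (hq : |q| ≤ Q) (ht : |t| ≤ Q)
    (hu : |u| ≤ a) (hv : |v| ≤ Q) (hw : |w| ≤ a) : |r * s| ≤ 3 * a * Q := by
  have ha : 0 ≤ a := (abs_nonneg _).trans hp
  have hQ : 0 ≤ Q := (abs_nonneg _).trans hq
  have h1 : |p * q| ≤ a * Q := by rw [abs_mul]; gcongr
  have h2 : |t * u| ≤ Q * a := by rw [abs_mul]; gcongr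
  have h3 : |v * w| ≤ Q * a := by rw [abs_mul]; gcongr
  have h4 : r * s = t * u + v * w - p * q := by linarith
  rw [h4]
  refine (abs_sub _ _).trans ?_
  have := abs_add_le (t * u) (v * w)
  linarith

lemma monodromy_comm (N n : ℕ) (x : Torus d) :
    monodromy T V E N (T^[n] x) * monodromy T V E n x =
      monodromy T V E n (T^[N] x) * monodromy T V E N x := by
  rw [← monodromy_add, ← monodromy_add, add_comm]

lemma half_norm_le_of_small {N : ℕ} {x : Torus d} {a l : ℝ} (hal : a < l / 2)
    (hl : l ≤ monodromyNorm T V E N x) : ∃ i j, l / 2 ≤ |monodromy T V E N x i j| ∧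
      a < |monodromy T V E N x i j| := by
  by_contra! hcon
  have : ∀ i j, |monodromy T V E N x i j| < l / 2 := fun i j => by
    by_contra h
    exact absurd (hcon i j (not_lt.1 h)) (not_le.2 (hal.trans_le (not_lt.1 h)))
  have hmax : ∃ b < l / 2, ∀ i j, |monodromy T V E N x i j| ≤ b := by
    refine ⟨max (max |monodromy T V E N x 0 0| |monodromy T V E N x 0 1|)
      (max |monodromy T V E N x 1 0| |monodromy T V E N x 1 1|), ?_, ?_⟩
    · simp [this]
    · intro i j
      fin_cases i <;> fin_cases j <;> simp
  obtain ⟨b, hb, hb'⟩ := hmax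
  linarith [monodromyNorm_le_two_mul hb']

/-- If the first column of `M_N` is small at `x` and at `T^(n+1) x`, then `f_n x` is small. -/
lemma abs_mul_le_of_small_columns {N n : ℕ} {x : Torus d} {a l Q : ℝ} (hal : a < l / 2)
    (hl : l ≤ monodromyNorm T V E N (T^[n + 1] x))
    (hx : ∀ i, |monodromy T V E N x i 0| ≤ a)
    (hx' : ∀ i, |monodromy T V E N (T^[n + 1] x) i 0| ≤ a)
    (hQ : ∀ y i j, |monodromy T V E (n + 1) y i j| ≤ Q) :
    |monodromy T V E n x 0 0| * (l / 2) ≤ 3 * a * Q := by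
  obtain ⟨i, j, hij, haij⟩ := half_norm_le_of_small hal hl
  -- The entry that carries the norm exceeds `a`, hence sits in the second column, the one
  -- multiplied by `f_n` in the commutation identity.
  have hj : j = 1 := by
    fin_cases j
    · exact absurd haij (not_lt.2 (hx' i))
    · rfl
  subst hj
  have h := congrFun (congrFun (monodromy_comm (T := T) (V := V) (E := E) N (n + 1) x) i) 0
  rw [Matrix.mul_apply, Matrix.mul_apply, Fin.sum_univ_two, Fin.sum_univ_two,
    monodromy_succ_apply_one T V E n x 0] at h
  have key := abs_mul_le_of_add_eq h (hx' i) (hQ _ _ _) (hQ _ _ _) (hx 0) (hQ _ _ _) (hx 1)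
  rw [abs_mul, mul_comm] at key
  exact le_trans (by gcongr) key

/-- If the first row of `M_N` is small at `x` and at `T^(n+1) x`, then `f_n (T^(N+1) x)` is
small. -/
lemma abs_mul_le_of_small_rows {N n : ℕ} {x : Torus d} {a l Q : ℝ} (hal : a < l / 2)
    (hl : l ≤ monodromyNorm T V E N x)
    (hx : ∀ j, |monodromy T V E N x 0 j| ≤ a)
    (hx' : ∀ j, |monodromy T V E N (T^[n + 1] x) 0 j| ≤ a)
    (hQ : ∀ y i j, |monodromy T V E (n + 1) y i j| ≤ Q) :
    |monodromy T V E n (T^[N + 1] x) 0 0| * (l / 2) ≤ 3 * a * Q := by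
  obtain ⟨i, j, hij, haij⟩ := half_norm_le_of_small hal hl
  have hi : i = 1 := by
    fin_cases i
    · exact absurd haij (not_lt.2 (hx j))
    · rfl
  subst hi
  have h := congrFun (congrFun (monodromy_comm (T := T) (V := V) (E := E) N (n + 1) x) 0) j
  rw [Matrix.mul_apply, Matrix.mul_apply, Fin.sum_univ_two, Fin.sum_univ_two,
    monodromy_apply_right_one T V E n (T^[N] x) 0, ← Function.iterate_succ_apply' T N x] at h
  have h' := h.symm
  rw [mul_comm (monodromy T V E (n + 1) (T^[N] x) 0 0),
    mul_comm (monodromy T V E N (T^[n + 1] x) 0 0),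
    mul_comm (monodromy T V E N (T^[n + 1] x) 0 1)] at h'
  have key := abs_mul_le_of_add_eq h' (hx j) (hQ _ _ _) (hQ _ _ _) (hx' 0) (hQ _ _ _) (hx' 1)
  rw [abs_mul, abs_neg] at key
  exact le_trans (by gcongr) key

/-- If `f_(p+1)` is tiny on the whole torus, and the points return to themselves at odd times,
then `M_(p+2)` is nearly orthogonal. -/
lemma monodromyNorm_le_of_flat {p : ℕ} {h η Q r k₀ : ℝ} (hh : 0 < h) (hrh : r < h)
    (hQ1 : 1 ≤ Q) (hηQ : η * Q ≤ 1 / 2) (hV : ∀ x, |V x - E| ≤ Q)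
    (hM : ∀ y i j, |monodromy T V E (p + 1) y i j| ≤ Q)
    (hext : LineExtends h Q fun x => monodromy T V E p x 0 0)
    (hret : ∀ x, ∃ k : ℕ, T^[2 * k + 1] x ∈ Metric.ball x r ∧ (k : ℝ) ≤ k₀)
    (hflat : ∀ x, |monodromy T V E (p + 1) x 0 0| ≤ η) (x : Torus d) :
    monodromyNorm T V E (p + 2) x ≤
      1 + (3 * (Q * η) + 2 / h * (Q ^ 2 * r) + 4 * (k₀ * (η * Q ^ 3))) := by
  set g : Torus d → ℝ := fun x => monodromy T V E p x 0 0 with hg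
  have hη : 0 ≤ η := (abs_nonneg _).trans (hflat x)
  have hgQ : ∀ y, |g y| ≤ Q := fun y => hext.abs_le hh y
  have hprod : ∀ y, |g y * g (T y) - 1| ≤ η * Q := by
    intro y
    have h1 := monodromy_det_identity T V E p y
    have h2 : g y * g (T y) - 1 =
        -(monodromy T V E (p + 1) y 0 0 * monodromy T V E (p + 1) y 1 1) := by
      simp only [hg]; linarith
    rw [h2, abs_neg, abs_mul]
    gcongr
    · exact hflat y
    · exact hM y 1 1
  -- Subtract `g y * g (T y) ≈ 1` from the same relation at `T y` and divide by `g (T y)`, which is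
  -- at least `1 / (2 Q)` in modulus.
  have htwo : ∀ y, |g (T (T y)) - g y| ≤ 4 * (η * Q ^ 2) := by
    intro y
    have h1 := abs_le.1 (hprod y)
    have h2 := abs_le.1 (hprod (T y))
    have h3 : |g (T y)| * |g (T (T y)) - g y| ≤ 2 * (η * Q) := by
      rw [← abs_mul, abs_le]
      constructor <;> nlinarith
    have h4 : 1 / 2 ≤ |g y| * |g (T y)| := by
      rw [← abs_mul]
      refine le_trans ?_ (le_abs_self _)
      linarith
    have h5 : 1 / 2 ≤ Q * |g (T y)| := h4.trans (by gcongr; exact hgQ y)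
    have h6 := abs_nonneg (g (T (T y)) - g y)
    calc |g (T (T y)) - g y| = 2 * ((1 / 2) * |g (T (T y)) - g y|) := by ring
      _ ≤ 2 * ((Q * |g (T y)|) * |g (T (T y)) - g y|) := by gcongr
      _ = 2 * (Q * (|g (T y)| * |g (T (T y)) - g y|)) := by ring
      _ ≤ 2 * (Q * (2 * (η * Q))) := by gcongr
      _ = _ := by ring
  have heven : ∀ (k : ℕ) y, |g (T^[2 * k] y) - g y| ≤ k * (4 * (η * Q ^ 2)) := by
    intro k y
    induction k with
    | zero => simp
    | succ k ih =>
      rw [show 2 * (k + 1) = 2 * k + 1 + 1 by ring, Function.iterate_succ_apply',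
        Function.iterate_succ_apply']
      have h1 := htwo (T^[2 * k] y)
      have h2 := abs_sub_le (g (T (T (T^[2 * k] y)))) (g (T^[2 * k] y)) (g y)
      push_cast
      linarith
  -- After an odd time `2k + 1` the orbit is near `y`, so `g` there is close to `g y` by the
  -- Lipschitz bound and to `g (T y)` by `k` double steps. Hence `g y ^ 2` is close to `g y * g (T
  -- y) ≈ 1`.
  have hsq : ∀ y, |g y| ≤ 1 + (η * Q + 2 / h * (Q ^ 2 * r) + 4 * (k₀ * (η * Q ^ 3))) := by
    intro y
    obtain ⟨k, hk, hkk⟩ := hret y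
    rw [Metric.mem_ball] at hk
    have hlip := hext.abs_sub_le hh (hk.trans hrh)
    have h1 : |g (T^[2 * k + 1] y) - g y| ≤ 2 * Q / h * r := hlip.trans (by gcongr)
    have h2 := heven k (T y)
    rw [← Function.iterate_succ_apply] at h2
    have h3 : |g y - g (T y)| ≤ 2 * Q / h * r + k₀ * (4 * (η * Q ^ 2)) := by
      have h4 := abs_sub_le (g y) (g (T^[2 * k + 1] y)) (g (T y))
      rw [abs_sub_comm (g y) (g (T^[2 * k + 1] y))] at h4
      have h5 : (k : ℝ) * (4 * (η * Q ^ 2)) ≤ k₀ * (4 * (η * Q ^ 2)) := by gcongr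
      have h2' : |g (T^[2 * k + 1] y) - g (T y)| ≤ k * (4 * (η * Q ^ 2)) := h2
      linarith
    set ω := η * Q + 2 / h * (Q ^ 2 * r) + 4 * (k₀ * (η * Q ^ 3)) with hω
    have h6 : g y ^ 2 ≤ 1 + ω := by
      have h7 : g y ^ 2 = g y * g (T y) + g y * (g y - g (T y)) := by ring
      have h8 : g y * (g y - g (T y)) ≤ Q * (2 * Q / h * r + k₀ * (4 * (η * Q ^ 2))) := by
        refine (le_abs_self _).trans ?_
        rw [abs_mul]
        gcongr
        exact hgQ y
      have h9 := (abs_le.1 (hprod y)).2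
      have h10 : Q * (2 * Q / h * r + k₀ * (4 * (η * Q ^ 2))) =
          2 / h * (Q ^ 2 * r) + 4 * (k₀ * (η * Q ^ 3)) := by ring
      linarith
    have hr0 : 0 < r := dist_nonneg.trans_lt hk
    have hk₀ : 0 ≤ k₀ := (Nat.cast_nonneg k).trans hkk
    have hω0 : 0 ≤ ω := by positivity
    rw [← sq_abs] at h6
    nlinarith [abs_nonneg (g y)]
  set ω := η * Q + 2 / h * (Q ^ 2 * r) + 4 * (k₀ * (η * Q ^ 3)) with hω
  have h00 : |monodromy T V E (p + 2) x 0 0| ≤ 1 + ω + Q * η := by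
    rw [monodromy_succ_apply_zero, monodromy_succ_apply_one]
    refine (abs_sub _ _).trans ?_
    rw [abs_mul]
    have h1 : |V (T^[p + 1 + 1] x) - E| * |monodromy T V E (p + 1) x 0 0| ≤ Q * η := by
      gcongr
      · exact hV _
      · exact hflat x
    have h2 := hsq x
    simp only [hg] at h2
    linarith
  have h11 : |monodromy T V E (p + 2) x 1 1| ≤ 1 + ω + Q * η := by
    rw [monodromy_succ_apply_one, monodromy_apply_right_one, abs_neg]
    have h2 := hsq (T x)
    simp only [hg] at h2
    have : 0 ≤ Q * η := by positivity
    linarith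
  have h10 : |monodromy T V E (p + 2) x 1 0| ≤ η := by
    rw [monodromy_succ_apply_one]; exact hflat x
  have h01 : |monodromy T V E (p + 2) x 0 1| ≤ η := by
    rw [monodromy_apply_right_one, abs_neg]; exact hflat _
  refine (opNorm_le_max_add _ _ _ h00 h11 h01 h10).trans ?_
  nlinarith

end Cocycle

/-! ### Spreading smallness, and the contradiction at short scale -/

section Main

open Filter Set

lemma half_le_diam_ball {d : ℕ} (hd : 1 ≤ d) (y : Torus d) {r : ℝ} (hr0 : 0 < r)
    (hr : r ≤ 1 / 2) : r / 2 ≤ Metric.diam (Metric.ball y r) := by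
  have : Nonempty (Fin d) := ⟨⟨0, hd⟩⟩
  set z : Torus d := y + proj fun _ => r / 2 with hz
  have hdist : dist z y = r / 2 := by
    rw [dist_eq_norm, hz, add_sub_cancel_left]
    have h1 : proj (d := d) (fun _ => r / 2) = fun _ => ((r / 2 : ℝ) : UnitAddCircle) := rfl
    rw [h1, pi_norm_const, (AddCircle.norm_coe_eq_abs_iff 1 one_ne_zero).2
      (by rw [abs_of_pos (by positivity), abs_one]; linarith), abs_of_pos (by positivity)]
  rw [← hdist]
  refine Metric.dist_le_diam_of_mem Metric.isBounded_ball ?_ (Metric.mem_ball_self hr0)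
  rw [Metric.mem_ball, hdist]
  linarith

/-- Absorbs the dimensional loss of the slicing lemmas into a larger exponent. The factor `1 *`
matches the shape of `eventually_mul_exp_le`. -/
lemma ofReal_exp_le_of_le_mul {d : ℕ} {s t : ℝ} (h : 2 * 4 ^ d * Real.exp (1 * s - t) ≤ 1)
    {u w : ENNReal} (hu : ENNReal.ofReal (Real.exp (-s)) ≤ u) (huw : u ≤ 2 * 4 ^ d * w) :
    ENNReal.ofReal (Real.exp (-t)) ≤ w := by
  have hc0 : (2 * 4 ^ d : ENNReal) ≠ 0 := by positivity
  have hct : (2 * 4 ^ d : ENNReal) ≠ ⊤ := by finiteness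
  rw [← ENNReal.mul_le_mul_iff_right hc0 hct]
  refine le_trans ?_ (hu.trans huw)
  have : (2 * 4 ^ d : ENNReal) = ENNReal.ofReal (2 * 4 ^ d) := by
    rw [ENNReal.ofReal_mul (by norm_num), ENNReal.ofReal_pow (by norm_num)]
    simp
  rw [this, ← ENNReal.ofReal_mul (by positivity)]
  apply ENNReal.ofReal_le_ofReal
  have h1 : Real.exp (1 * s - t) = Real.exp (-t) / Real.exp (-s) := by
    rw [← Real.exp_sub]; ring_nf
  rwa [h1, ← mul_div_assoc, div_le_one (Real.exp_pos _)] at h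

variable {d : ℕ} {T : Torus d → Torus d} {V : Torus d → ℝ}

/-- No determinant of small order is tiny on the whole torus. -/
lemma eventually_not_flat (hd : 1 ≤ d) (hret : PolynomialReturn T) {h K B γ : ℝ} (hh : 0 < h)
    (hK : 0 ≤ K) (hV : ∀ n : ℕ, LineExtends h K fun x => V (T^[n] x)) (hγ : 0 < γ) :
    ∀ᶠ N : ℕ in atTop, ∀ E : ℝ, K + |E| + 1 ≤ B → γ < lyapunov T V E → ∀ n : ℕ,
      (n : ℝ) ≤ (N : ℝ) ^ (1 / 5 : ℝ) →
      ¬ ∀ x, |monodromy T V E n x 0 0| ≤ Real.exp (-(N : ℝ) ^ (1 / 2 : ℝ)) := by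
  obtain ⟨A, hA, C, hC, hret⟩ := hret
  set b := Real.log B with hb
  have hγ3 : 0 < γ / 3 := by positivity
  filter_upwards [eventually_ge_atTop 1,
    eventually_mul_rpow_le (show (1 / 5 : ℝ) < 9 / 40 by norm_num) b,
    eventually_mul_exp_le (show (9 / 40 : ℝ) < 1 / 2 by norm_num) (by norm_num) 1 3 hγ3,
    eventually_mul_exp_le (show (9 / 40 : ℝ) < 1 / 2 by norm_num) (by norm_num) 1 1
      (show (0 : ℝ) < 1 / 2 by norm_num),
    eventually_mul_exp_le (show (9 / 40 : ℝ) < 1 / 4 by norm_num) (by norm_num) 2 (2 / h) hγ3,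
    eventually_mul_exp_le (show (1 / 4 : ℝ) < 1 / 2 by norm_num) (by norm_num) (A + 3)
      (4 * C * 2 ^ A) hγ3,
    eventually_mul_exp_le (show (0 : ℝ) < 1 / 4 by norm_num) (by norm_num) 0 1
      (show (0 : ℝ) < min (h / 2) (1 / 2) by positivity),
    eventually_mul_rpow_le (show (9 / 40 : ℝ) < 1 / 4 by norm_num) 1]
    with N hN1 hQe h3 h4 h5 h6 h7 h8 E hB hL n hn hflat
  have hN1' : (1 : ℝ) ≤ N := by exact_mod_cast hN1
  have hB1 : 1 ≤ B := by linarith [abs_nonneg E]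
  have hVK : ∀ x, |V x| ≤ K := fun x => (hV 0).abs_le hh x
  obtain _ | p := n
  · have h1 := hflat 0
    simp only [monodromy, Matrix.one_apply_eq, abs_one] at h1
    have : 0 < (N : ℝ) ^ (1 / 2 : ℝ) := by positivity
    linarith [Real.exp_lt_one_iff.2 (neg_lt_zero.2 this)]
  -- The exponents are ordered `1/5 < 9/40 < 1/4 < 1/2`: `r` beats powers of the matrix bound `Q`,
  -- and `η` beats both these and the return time, of order `r^(-A)`.
  set η := Real.exp (-(N : ℝ) ^ (1 / 2 : ℝ)) with hη
  set Q := Real.exp ((N : ℝ) ^ (9 / 40 : ℝ)) with hQ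
  set r := Real.exp (-(N : ℝ) ^ (1 / 4 : ℝ)) with hr
  have hBQ : ∀ m : ℕ, m ≤ p + 1 → B ^ m ≤ Q := by
    intro m hm
    calc B ^ m ≤ B ^ (p + 1) := pow_le_pow_right₀ hB1 hm
      _ = Real.exp (b * ((p + 1 : ℕ) : ℝ)) := by
          rw [mul_comm, Real.exp_nat_mul, hb, Real.exp_log (by linarith)]
      _ ≤ Real.exp (b * (N : ℝ) ^ (1 / 5 : ℝ)) := by
          gcongr
          exact Real.log_nonneg hB1
      _ ≤ Q := Real.exp_le_exp.2 hQe
  have hQ1 : 1 ≤ Q := Real.one_le_exp (by positivity)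
  simp only [zero_mul, zero_sub, one_mul] at h7
  rw [← hr, le_min_iff] at h7
  have hr0 : 0 < r := Real.exp_pos _
  have hext := lineExtends_monodromy (E := E) hK hV hB p
  have hkey := monodromyNorm_le_of_flat (E := E) (p := p) (h := h) (η := η) (Q := Q) (r := r)
    (k₀ := C * (r / 2) ^ (-A)) hh (by linarith) hQ1 ?_ ?_ ?_ ?_ ?_ hflat
  · set t := 3 * (Q * η) + 2 / h * (Q ^ 2 * r) + 4 * (C * (r / 2) ^ (-A) * (η * Q ^ 3)) with ht
    have ht0 : 0 ≤ t := by positivity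
    have htγ : t ≤ γ := by
      have e1 : 3 * (Q * η) ≤ γ / 3 := by
        rw [hQ, hη, ← Real.exp_add]
        refine le_trans (le_of_eq ?_) h3
        ring_nf
      have e2 : 2 / h * (Q ^ 2 * r) ≤ γ / 3 := by
        rw [hQ, hr, ← Real.exp_nat_mul, ← Real.exp_add]
        refine le_trans (le_of_eq ?_) h5
        push_cast
        ring_nf
      have e3 : 4 * (C * (r / 2) ^ (-A) * (η * Q ^ 3)) ≤ γ / 3 := by
        have hrA : (r / 2) ^ (-A) = 2 ^ A * Real.exp (A * (N : ℝ) ^ (1 / 4 : ℝ)) := by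
          rw [Real.div_rpow hr0.le (by norm_num), hr, ← Real.exp_mul,
            Real.rpow_neg (by norm_num), div_inv_eq_mul, mul_comm]
          congr 2
          ring
        have hQ3 : Q ^ 3 ≤ Real.exp (3 * (N : ℝ) ^ (1 / 4 : ℝ)) := by
          rw [hQ, ← Real.exp_nat_mul]
          apply Real.exp_le_exp.2
          push_cast
          linarith
        calc 4 * (C * (r / 2) ^ (-A) * (η * Q ^ 3))
            ≤ 4 * (C * (2 ^ A * Real.exp (A * (N : ℝ) ^ (1 / 4 : ℝ))) *
                (η * Real.exp (3 * (N : ℝ) ^ (1 / 4 : ℝ)))) := by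
              rw [hrA]; gcongr
          _ = 4 * C * 2 ^ A * Real.exp ((A + 3) * (N : ℝ) ^ (1 / 4 : ℝ) -
                (N : ℝ) ^ (1 / 2 : ℝ)) := by
              rw [hη, show (A + 3) * (N : ℝ) ^ (1 / 4 : ℝ) - (N : ℝ) ^ (1 / 2 : ℝ) =
                A * (N : ℝ) ^ (1 / 4 : ℝ) + (-(N : ℝ) ^ (1 / 2 : ℝ) +
                  3 * (N : ℝ) ^ (1 / 4 : ℝ)) by ring, Real.exp_add, Real.exp_add]
              ring
          _ ≤ _ := h6
      linarith
    have hlog : ∀ x, logNorm T V E (p + 2) x ≤ γ := by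
      intro x
      rw [logNorm_eq]
      calc Real.log (monodromyNorm T V E (p + 2) x) ≤ Real.log (1 + t) :=
            Real.log_le_log (monodromyNorm_pos _ _) (hkey x)
        _ ≤ t := by
            have := Real.log_le_sub_one_of_pos (show 0 < 1 + t by linarith)
            linarith
        _ ≤ γ := htγ
    have h1 := finiteLyapunov_le (n := p + 2) (by omega) hγ.le hlog
    have h2 := lt_finiteLyapunov hγ hL (n := p + 2) (by omega)
    linarith
  · rw [hQ, hη, ← Real.exp_add]
    refine le_trans (le_of_eq ?_) h4
    ring_nf
  · intro x
    have h1 := abs_sub (V x) E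
    have h2 := hBQ 1 (by omega)
    have h3 := hVK x
    rw [pow_one] at h2
    linarith
  · intro y i j
    exact (abs_monodromy_le hVK hB (p + 1) y i j).trans (hBQ _ le_rfl)
  · intro x v hv
    obtain ⟨φ, h1, h2, h3⟩ := hext x v hv
    exact ⟨φ, h1, fun z hz => (h2 z hz).trans (hBQ p (by omega)), h3⟩
  · intro x
    obtain ⟨k, -, hk1, hk2⟩ := hret x r hr0 x
    refine ⟨k, hk1, hk2.trans ?_⟩
    gcongr C * ?_
    refine Real.rpow_le_rpow_of_nonpos (by positivity) ?_ (by linarith)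
    exact half_le_diam_ball hd x hr0 (by linarith [h7.2])

/-- A determinant of small order that is tiny on a set that is not too small is tiny on the whole
torus. -/
lemma eventually_flat_of_small {h K B : ℝ} (hh : 0 < h) (hK : 0 ≤ K)
    (hV : ∀ n : ℕ, LineExtends h K fun x => V (T^[n] x))
    (hT : Measurable T) (hVm : Measurable V) :
    ∀ᶠ N : ℕ in atTop, ∀ E : ℝ, K + |E| + 1 ≤ B → ∀ n : ℕ,
      (n : ℝ) ≤ (N : ℝ) ^ (1 / 5 : ℝ) →
      ENNReal.ofReal (Real.exp (-(N : ℝ) ^ (1 / 10 : ℝ))) ≤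
        volume {x : Torus d | |monodromy T V E n x 0 0| ≤ Real.exp (-(N : ℝ) ^ (9 / 10 : ℝ))} →
      ∀ x, |monodromy T V E n x 0 0| ≤ Real.exp (-(N : ℝ) ^ (1 / 2 : ℝ)) := by
  set b := Real.log B with hb
  -- Order at most `N^(1/5)` keeps `f_n` below `exp (N^(1/2))` on the strip. The measure exponent
  -- `1/10` is raised to `1/5` to pay for slicing.
  filter_upwards [eventually_strip_remez hh (show (0 : ℝ) < 1 / 5 by norm_num)
      (show (0 : ℝ) < 1 / 2 by norm_num) (show (1 / 5 + 1 / 2 : ℝ) < 9 / 10 by norm_num),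
    eventually_mul_rpow_le (show (1 / 5 : ℝ) < 1 / 2 by norm_num) b,
    eventually_mul_exp_le (show (1 / 10 : ℝ) < 1 / 5 by norm_num) (by norm_num) 1 (2 * 4 ^ d)
      one_pos] with N hremez hbN hvolN E hB n hn hS x
  have hB1 : 1 ≤ B := by linarith [abs_nonneg E]
  set S : Set (Torus d) :=
    {x | |monodromy T V E n x 0 0| ≤ Real.exp (-(N : ℝ) ^ (9 / 10 : ℝ))} with hSdef
  have hSm : MeasurableSet S :=
    measurableSet_le (measurable_monodromy hT hVm n 0 0).abs measurable_const
  obtain ⟨v, hv, hvol⟩ := exists_long_segment hSm x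
  obtain ⟨φ, hφd, hφb, hφ⟩ := lineExtends_monodromy (E := E) hK hV hB n x v hv
  have hproj0 : proj ((0 : ℝ) • v) = 0 := by funext i; simp [proj]
  have key := hremez φ {s ∈ Icc (0 : ℝ) 1 | x + proj (s • v) ∈ S} hφd ?_ (sep_subset _ _) ?_ ?_ 0
    (by simp)
  · rw [hφ, hproj0, add_zero, Complex.norm_real] at key
    exact key
  · intro z hz
    refine (hφb z (by linarith)).trans ?_
    calc B ^ n = Real.exp (b * n) := by
          rw [mul_comm, Real.exp_nat_mul, hb, Real.exp_log (by linarith)]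
      _ ≤ Real.exp (b * (N : ℝ) ^ (1 / 5 : ℝ)) := by
          gcongr
          exact Real.log_nonneg hB1
      _ ≤ _ := Real.exp_le_exp.2 hbN
  · exact ofReal_exp_le_of_le_mul hvolN hS hvol
  · intro s hs
    rw [hφ, Complex.norm_real]
    exact hs.2

/-- If the determinant is small on a set that is not too small, then it is small on a ball of
polynomial size. -/
lemma eventually_small_on_ball {h K B θ κ τ : ℝ} (hh : 0 < h) (hK : 0 ≤ K)
    (hV : ∀ n : ℕ, LineExtends h K fun x => V (T^[n] x))
    (hθ : 0 < θ) (hθ1 : θ < 1) (hθκ : θ / 2 < κ) (hτ : 0 < τ) (hτθ : 6 * τ < θ) :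
    ∀ᶠ N : ℕ in atTop, ∀ E : ℝ, K + |E| + 1 ≤ B → ∀ P : ℝ, 0 ≤ P →
      (∀ x, |monodromy T V E N x 0 0| ≤ Real.exp (P + (N : ℝ) ^ (1 - κ))) →
      ∀ S : Set (Torus d), MeasurableSet S →
        (∀ x ∈ S, |monodromy T V E N x 0 0| ≤ Real.exp (P - (N : ℝ) ^ (1 - τ))) →
        ENNReal.ofReal (Real.exp (-(N : ℝ) ^ τ)) ≤ volume S →
        ∃ y : Torus d, ∀ x ∈ Metric.closedBall y ((N : ℝ) ^ (-θ) / 2),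
          |monodromy T V E N x 0 0| ≤ Real.exp (P - (N : ℝ) ^ (1 - θ / 2)) := by
  set b := Real.log B with hb
  filter_upwards [eventually_strip_remez one_pos (show (0 : ℝ) < 2 * τ by linarith)
      (show (0 : ℝ) < 1 - θ / 2 by linarith) (show 2 * τ + (1 - θ / 2) < 1 - τ by linarith),
    eventually_ge_atTop 1,
    eventually_mul_rpow_le (show 1 - κ < 1 - θ / 2 by linarith) 2,
    eventually_mul_rpow_le (show 1 - θ < 1 - θ / 2 by linarith) (2 * (b * (2 / h))),
    eventually_le_rpow hθ 2, eventually_le_rpow hθ (2 / h),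
    eventually_mul_exp_le (show τ < 2 * τ by linarith) (by linarith) 1 (2 * 4 ^ d)
      one_pos] with N hremez hN1 hNκ hNθ hN2 hNh hvolN E hB P hP hup S hSm hS hSvol
  have hN1' : (1 : ℝ) ≤ N := by exact_mod_cast hN1
  have hN0 : (0 : ℝ) < N := by linarith
  have hB1 : 1 ≤ B := by linarith [abs_nonneg E]
  have hb0 : 0 ≤ b := Real.log_nonneg hB1
  set r := (N : ℝ) ^ (-θ) with hr
  have hr0 : 0 < r := by positivity
  have hrinv : r * (N : ℝ) ^ θ = 1 := by
    rw [hr, ← Real.rpow_add hN0, neg_add_cancel, Real.rpow_zero]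
  have hr2 : r ≤ 1 / 2 := by nlinarith
  have hrh : 2 * r ≤ h := by
    rw [div_le_iff₀ hh] at hNh
    nlinarith
  obtain ⟨y, hy⟩ := exists_ball_segments hSm hr0 hr2
  refine ⟨y, fun x hx => ?_⟩
  obtain ⟨v, hv, hvol⟩ := hy x hx
  -- The direction is stretched by `1 / (2 r)` and the variable shrunk by `2 r`, so that Remez on
  -- the strip of half-width one sees only imaginary parts up to `2 r`.
  obtain ⟨φ, hφd, hφb, hφ⟩ := lineExtends_monodromy (E := E) hK hV hB N x ((2 * r)⁻¹ • v) (by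
    rw [norm_smul, norm_inv, Real.norm_eq_abs, abs_of_pos (by positivity),
      inv_mul_le_iff₀ (by positivity)]
    linarith)
  have hφ' : ∀ s : ℝ, φ (((2 * r : ℝ) : ℂ) * s) =
      (monodromy T V E N (x + proj (s • v)) 0 0 : ℂ) := by
    intro s
    rw [← Complex.ofReal_mul, hφ, smul_smul]
    congr 6
    field_simp
  have him : ∀ z : ℂ, |(((2 * r : ℝ) : ℂ) * z).im| = 2 * r * |z.im| := by
    intro z
    rw [Complex.im_ofReal_mul, abs_mul, abs_of_pos (by positivity)]
  have hnorm : ∀ z : ℂ, ‖(Real.exp (-P) : ℂ) * φ (((2 * r : ℝ) : ℂ) * z)‖ =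
      Real.exp (-P) * ‖φ (((2 * r : ℝ) : ℂ) * z)‖ := by
    intro z
    rw [norm_mul, Complex.norm_real, Real.norm_eq_abs, Real.abs_exp]
  have hproj0 : proj ((0 : ℝ) • v) = 0 := by funext i; simp [proj]
  have key := hremez (fun z => (Real.exp (-P) : ℂ) * φ (((2 * r : ℝ) : ℂ) * z))
    {s ∈ Icc (0 : ℝ) 1 | x + proj (s • v) ∈ S} ?_ ?_ (sep_subset _ _) ?_ ?_ 0 (by simp)
  · rw [hnorm, hφ', hproj0, add_zero, Complex.norm_real, Real.norm_eq_abs, Real.exp_neg,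
      inv_mul_le_iff₀ (Real.exp_pos _), ← Real.exp_add] at key
    exact key
  · refine DifferentiableOn.const_mul ?_ _
    refine hφd.comp (by fun_prop) ?_
    intro z hz
    change |(((2 * r : ℝ) : ℂ) * z).im| < 2 * h
    rw [him]
    have : |z.im| < 2 * 1 := hz
    nlinarith [abs_nonneg z.im]
  · intro z hz
    rw [hnorm]
    have hzim : |(((2 * r : ℝ) : ℂ) * z).im| ≤ 2 * r := by
      rw [him]; nlinarith
    -- The trivial bound `B^N` at height `h` costs only a multiple of `N^(1-θ)` at height `2 r`;
    -- both errors fit under `N^(1-θ/2)`.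
    have h1 := norm_le_exp_of_strip hh hφd (a := P + (N : ℝ) ^ (1 - κ)) (b := b * N)
      (by positivity) (fun w hw => by
        refine (hφb w (by linarith)).trans (le_of_eq ?_)
        rw [mul_comm, Real.exp_nat_mul, hb, Real.exp_log (by linarith)])
      (fun t => by rw [hφ, Complex.norm_real]; exact hup _)
      (z := ((2 * r : ℝ) : ℂ) * z) (hzim.trans hrh)
    calc _ ≤ Real.exp (-P) * Real.exp (P + (N : ℝ) ^ (1 - κ) + b * N * (2 * r) / h) := by
          gcongr
          refine h1.trans ?_
          gcongr
      _ = Real.exp ((N : ℝ) ^ (1 - κ) + b * (2 / h) * (N : ℝ) ^ (1 - θ)) := by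
          rw [← Real.exp_add, hr, sub_eq_add_neg 1 θ, Real.rpow_add hN0, Real.rpow_one]
          congr 1
          ring
      _ ≤ _ := by
          apply Real.exp_le_exp.2
          linarith
  · exact ofReal_exp_le_of_le_mul hvolN hSvol hvol
  · intro s hs
    rw [hnorm, hφ', Complex.norm_real, Real.exp_neg, inv_mul_le_iff₀ (Real.exp_pos _),
      ← Real.exp_add]
    exact hS _ hs.2

end Main

/-! ### Descent from order `N` to a short order -/

section Return

open Filter Set

variable {d : ℕ} {T : Torus d → Torus d} {V : Torus d → ℝ}

/-- If the determinant of order `N` is small on a ball of polynomial size, then some determinant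
of much smaller order is tiny on a set that is not too small. -/
lemma eventually_exists_small_det (hT : MeasurePreserving T volume volume) (hVm : Measurable V)
    {K B θ σ κ γ : ℝ} (hVK : ∀ x, |V x| ≤ K) (C : ℝ) (hθ : 0 < θ) (hθ10 : θ ≤ 1 / 10)
    (hθd : θ * d ≤ 1 / 10) (hσ : 0 < σ) (hθσ : θ / 2 < σ) (hθκ : θ / 2 < κ) (hγ : 0 < γ) :
    ∀ᶠ N : ℕ in atTop, ∀ E : ℝ, K + |E| + 1 ≤ B → ∀ P : ℝ, γ * N ≤ P →
      (∀ x, monodromyNorm T V E N x ≤ Real.exp (P + (N : ℝ) ^ (1 - κ))) →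
      volume {x : Torus d | monodromyNorm T V E N x < Real.exp (P - (N : ℝ) ^ (1 - σ))} ≤
        ENNReal.ofReal (C * Real.exp (-(N : ℝ) ^ σ)) →
      ∀ y : Torus d, (∀ x ∈ Metric.closedBall y ((N : ℝ) ^ (-θ) / 2),
          |monodromy T V E N x 0 0| ≤ Real.exp (P - (N : ℝ) ^ (1 - θ / 2))) →
      ∃ n : ℕ, (n : ℝ) ≤ (N : ℝ) ^ (1 / 5 : ℝ) ∧
        ENNReal.ofReal (Real.exp (-(N : ℝ) ^ (1 / 10 : ℝ))) ≤
          volume {x : Torus d |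
            |monodromy T V E n x 0 0| ≤ Real.exp (-(N : ℝ) ^ (9 / 10 : ℝ))} := by
  set b := Real.log B with hb
  filter_upwards [eventually_ge_atTop 1,
    eventually_mul_rpow_le (show (9 / 10 : ℝ) < 1 - θ / 2 by linarith) 16,
    eventually_mul_rpow_le (show 1 - σ < 1 - θ / 2 by linarith) 16,
    eventually_mul_rpow_le (show 1 - κ < 1 - θ / 2 by linarith) 4,
    eventually_mul_rpow_le (show (1 / 5 : ℝ) < 1 - θ / 2 by linarith) (16 * b),
    eventually_le_rpow (show 0 < 1 - θ / 2 by linarith) (16 * Real.log 6),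
    eventually_le_rpow (show 0 < 1 - θ / 2 by linarith) 4,
    eventually_mul_rpow_le (show 1 - θ / 2 < 1 by linarith) (3 / (8 * γ)),
    eventually_mul_rpow_le (show (1 / 10 : ℝ) < 1 / 5 by norm_num) 9,
    eventually_log_le_rpow (half_pos hσ) (1 / 10),
    eventually_mul_exp_le (half_lt_self hσ) hσ 1 C (show (0 : ℝ) < 1 / 2 by norm_num),
    eventually_log_le_rpow (show (0 : ℝ) < 1 / 20 by norm_num) (1 / 5),
    eventually_mul_exp_le (show (1 / 20 : ℝ) < 1 / 10 by norm_num) (by norm_num) 1 72 one_pos]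
    with N hN1 hm9 hmσ hmκ hmb hm6 hm4 hmγ hK9 hlogσ hCσ hlog5 h72
      E hB P hP hup hbad y hball
  have hN1' : (1 : ℝ) ≤ N := by exact_mod_cast hN1
  have hN0 : (0 : ℝ) < N := by linarith
  have hK0 : 0 ≤ K := (abs_nonneg _).trans (hVK 0)
  have hB1 : 1 ≤ B := by linarith [abs_nonneg E]
  have hb0 : 0 ≤ b := Real.log_nonneg hB1
  set m := (N : ℝ) ^ (1 - θ / 2) with hm
  set a := Real.exp (P - m / 4) with ha
  set l := Real.exp (P - (N : ℝ) ^ (1 - σ)) with hl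
  set R : ℝ := (N : ℝ) ^ (1 / 10 : ℝ) with hR
  have hR1 : 1 ≤ R := Real.one_le_rpow hN1' (by norm_num)
  have hlog62 : Real.log 2 < Real.log 6 := Real.log_lt_log (by norm_num) (by norm_num)
  have hal : a < l / 2 := by
    rw [lt_div_iff₀ two_pos, ha, hl, ← Real.exp_log (show (0 : ℝ) < 2 by norm_num),
      ← Real.exp_add]
    apply Real.exp_lt_exp.2
    linarith
  have hPm : 3 * m / 4 ≤ 2 * P := by
    rw [Real.rpow_one] at hmγ
    have : 3 / (8 * γ) * m * γ ≤ N * γ := by gcongr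
    have h2 : 3 / (8 * γ) * m * γ = 3 * m / 8 := by field_simp
    linarith
  -- A measurable hull of the exceptional set; off it the norm is at least `l`.
  set W := toMeasurable volume {x : Torus d | monodromyNorm T V E N x < l} with hW
  have hWm : MeasurableSet W := measurableSet_toMeasurable _ _
  have hWvol : volume W ≤ ENNReal.ofReal (C * Real.exp (-(N : ℝ) ^ σ)) := by
    rw [hW, measure_toMeasurable]; exact hbad
  have hnorm : ∀ x, x ∉ W → l ≤ monodromyNorm T V E N x := by
    intro x hx
    by_contra hcon
    exact hx (subset_toMeasurable _ _ (not_le.1 hcon))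
  set G := Metric.closedBall y ((N : ℝ) ^ (-θ) / 2) \ W with hG
  have hGm : MeasurableSet G := measurableSet_closedBall.diff hWm
  have h00 : ∀ x ∈ G, |monodromy T V E N x 0 0| ≤ a := by
    intro x hx
    refine (hball x hx.1).trans (Real.exp_le_exp.2 ?_)
    linarith
  have hcr : ∀ x ∈ G, |monodromy T V E N x 1 0| ≤ a ∨ |monodromy T V E N x 0 1| ≤ a := by
    intro x hx
    refine small_column_or_row (det_monodromy T V E N x) hm4 hPm (hball x hx.1) ?_
    refine (abs_monodromy_le_norm N x 1 1).trans ((hup x).trans (Real.exp_le_exp.2 ?_))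
    linarith
  have hGvol : ENNReal.ofReal (R⁻¹ / 2) ≤ volume G := by
    have h1 : ENNReal.ofReal R⁻¹ ≤ volume (Metric.closedBall y ((N : ℝ) ^ (-θ) / 2)) := by
      have hr1 : (N : ℝ) ^ (-θ) ≤ 1 := Real.rpow_le_one_of_one_le_of_nonpos hN1' (by linarith)
      rw [volume_closedBall_torus y (by positivity) (by linarith)]
      apply ENNReal.ofReal_le_ofReal
      rw [hR, ← Real.rpow_neg hN0.le, mul_div_cancel₀ _ two_ne_zero, ← Real.rpow_mul_natCast hN0.le]
      exact Real.rpow_le_rpow_of_exponent_le hN1' (by linarith)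
    have h2 : C * Real.exp (-(N : ℝ) ^ σ) ≤ R⁻¹ / 2 := by
      have h3 : R ≤ Real.exp ((N : ℝ) ^ (σ / 2)) := by
        rw [hR, Real.rpow_def_of_pos hN0]
        apply Real.exp_le_exp.2
        linarith
      have h4 : Real.exp (-(N : ℝ) ^ (σ / 2)) ≤ R⁻¹ := by
        rw [Real.exp_neg]
        exact inv_anti₀ (by linarith) h3
      calc C * Real.exp (-(N : ℝ) ^ σ)
          = C * Real.exp (1 * (N : ℝ) ^ (σ / 2) - (N : ℝ) ^ σ) *
              Real.exp (-(N : ℝ) ^ (σ / 2)) := by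
            rw [mul_assoc, ← Real.exp_add]; ring_nf
        _ ≤ 1 / 2 * Real.exp (-(N : ℝ) ^ (σ / 2)) := by gcongr
        _ ≤ 1 / 2 * R⁻¹ := by gcongr
        _ = _ := by ring
    refine le_trans ?_ (le_measure_sdiff (μ := volume) (s₂ := W))
    refine le_trans ?_ (tsub_le_tsub h1 (hWvol.trans (ENNReal.ofReal_le_ofReal h2)))
    rw [← ENNReal.ofReal_sub _ (by positivity)]
    apply ENNReal.ofReal_le_ofReal
    linarith
  set g : ℝ := R⁻¹ / 4 with hg
  have hg0 : 0 < g := by positivity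
  -- The ball has measure at least `1 / R`; removing `W` leaves half, and one of the column and row
  -- alternatives keeps half of that, `g`. Recurrence needs `k g ≥ 2`, hence `8 R`, and then `g / (2
  -- k) ≥ 1 / (72 R^2)`.
  set k : ℕ := ⌈8 * R⌉₊ with hk
  have hklow : 8 * R ≤ k := Nat.le_ceil _
  have hkup : (k : ℝ) ≤ 9 * R := by
    have := (Nat.ceil_lt_add_one (show 0 ≤ 8 * R by positivity)).le
    rw [← hk] at this
    linarith
  have hkg : 2 ≤ k * g := by
    calc (2 : ℝ) = 8 * R * g := by rw [hg]; field_simp; norm_num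
      _ ≤ k * g := by gcongr
  have hkpos : (0 : ℝ) < k := by linarith
  have hvol : Real.exp (-R) ≤ g / (2 * k) := by
    have h1 : R * R ≤ Real.exp ((N : ℝ) ^ (1 / 20 : ℝ)) := by
      rw [hR, ← Real.rpow_add hN0, Real.rpow_def_of_pos hN0]
      apply Real.exp_le_exp.2
      linarith
    have h2 : 72 * (R * R) * Real.exp (-R) ≤ 1 := by
      refine le_trans ?_ h72
      rw [one_mul, sub_eq_add_neg, Real.exp_add, mul_assoc]
      gcongr
    calc Real.exp (-R) ≤ 1 / (72 * (R * R)) := by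
          rw [le_div_iff₀ (by positivity)]; linarith
      _ = g / (2 * (9 * R)) := by rw [hg]; field_simp; norm_num
      _ ≤ _ := by gcongr
  have hord : ∀ n : ℕ, n + 1 < k → ((n + 1 : ℕ) : ℝ) ≤ (N : ℝ) ^ (1 / 5 : ℝ) := by
    intro n hn
    have : ((n + 1 : ℕ) : ℝ) ≤ k := by exact_mod_cast hn.le
    linarith
  have hQ : ∀ n : ℕ, n + 1 < k → ∀ z i j, |monodromy T V E (n + 1) z i j| ≤
      Real.exp (b * (N : ℝ) ^ (1 / 5 : ℝ)) := by
    intro n hn z i j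
    refine (abs_monodromy_le hVK hB (n + 1) z i j).trans ?_
    calc B ^ (n + 1) = Real.exp (b * ((n + 1 : ℕ) : ℝ)) := by
          rw [mul_comm, Real.exp_nat_mul, hb, Real.exp_log (by linarith)]
      _ ≤ _ := by
          gcongr
          exact hord n hn
  have htiny : ∀ t : ℝ, t * (l / 2) ≤ 3 * a * Real.exp (b * (N : ℝ) ^ (1 / 5 : ℝ)) →
      t ≤ Real.exp (-(N : ℝ) ^ (9 / 10 : ℝ)) := by
    intro t ht
    have h1 : 3 * a * Real.exp (b * (N : ℝ) ^ (1 / 5 : ℝ)) ≤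
        Real.exp (-(N : ℝ) ^ (9 / 10 : ℝ)) * (l / 2) := by
      have h2 : 6 * a * Real.exp (b * (N : ℝ) ^ (1 / 5 : ℝ)) ≤
          Real.exp (-(N : ℝ) ^ (9 / 10 : ℝ)) * l := by
        rw [ha, hl, ← Real.exp_log (show (0 : ℝ) < 6 by norm_num), ← Real.exp_add, ← Real.exp_add,
          ← Real.exp_add]
        apply Real.exp_le_exp.2
        linarith
      linarith
    exact le_of_mul_le_mul_right (ht.trans h1) (by positivity)
  set G₁ := G ∩ {x | |monodromy T V E N x 1 0| ≤ a} with hG₁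
  set G₂ := G ∩ {x | |monodromy T V E N x 0 1| ≤ a} with hG₂
  have hTm := hT.measurable
  have hG₁m : MeasurableSet G₁ :=
    hGm.inter (measurableSet_le (measurable_monodromy hTm hVm N 1 0).abs measurable_const)
  have hG₂m : MeasurableSet G₂ :=
    hGm.inter (measurableSet_le (measurable_monodromy hTm hVm N 0 1).abs measurable_const)
  have hsplit : ENNReal.ofReal g ≤ volume G₁ ∨ ENNReal.ofReal g ≤ volume G₂ := by
    by_contra! hcon
    have h1 : volume G ≤ volume G₁ + volume G₂ := by
      refine (measure_mono ?_).trans (measure_union_le _ _)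
      intro x hx
      exact (hcr x hx).imp (fun h => ⟨hx, h⟩) (fun h => ⟨hx, h⟩)
    have h2 : volume G₁ + volume G₂ < ENNReal.ofReal (R⁻¹ / 2) := by
      rw [show R⁻¹ / 2 = g + g by rw [hg]; ring, ENNReal.ofReal_add hg0.le hg0.le]
      exact ENNReal.add_lt_add hcon.1 hcon.2
    exact absurd (hGvol.trans h1) (not_le.2 h2)
  rcases hsplit with hvol₁ | hvol₂
  · obtain ⟨n', hn0, hnk, hret⟩ := exists_return hT hG₁m hg0 hvol₁ hkg
    obtain ⟨n, rfl⟩ : ∃ n, n' = n + 1 := ⟨n' - 1, by omega⟩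
    refine ⟨n, by have := hord n hnk; push_cast at this; linarith, ?_⟩
    refine (ENNReal.ofReal_le_ofReal hvol).trans (hret.trans (measure_mono ?_))
    rintro x ⟨hx, hx'⟩
    refine htiny _ (abs_mul_le_of_small_columns hal (hnorm _ hx'.1.2) ?_ ?_ (hQ n hnk))
    · exact Fin.forall_fin_two.2 ⟨h00 x hx.1, hx.2⟩
    · exact Fin.forall_fin_two.2 ⟨h00 _ hx'.1, hx'.2⟩
  · obtain ⟨n', hn0, hnk, hret⟩ := exists_return hT hG₂m hg0 hvol₂ hkg
    obtain ⟨n, rfl⟩ : ∃ n, n' = n + 1 := ⟨n' - 1, by omega⟩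
    refine ⟨n, by have := hord n hnk; push_cast at this; linarith, ?_⟩
    have hSm : MeasurableSet {x : Torus d |
        |monodromy T V E n x 0 0| ≤ Real.exp (-(N : ℝ) ^ (9 / 10 : ℝ))} :=
      measurableSet_le (measurable_monodromy hTm hVm n 0 0).abs measurable_const
    -- In the row case `f_n` is tiny at `T^(N+1) x`; invariance of the measure moves the estimate
    -- back.
    rw [← (hT.iterate (N + 1)).measure_preimage hSm.nullMeasurableSet]
    refine (ENNReal.ofReal_le_ofReal hvol).trans (hret.trans (measure_mono ?_))
    rintro x ⟨hx, hx'⟩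
    refine htiny _ (abs_mul_le_of_small_rows hal (hnorm _ hx.1.2) ?_ ?_ (hQ n hnk))
    · exact Fin.forall_fin_two.2 ⟨h00 x hx.1, hx.2⟩
    · exact Fin.forall_fin_two.2 ⟨h00 _ hx'.1, hx'.2⟩

end Return

end DetLDT

/-! ### The large deviation estimate for determinants -/

open DetLDT

theorem mainTheorem9 (d : ℕ) (hd : 1 ≤ d) (σ : ℝ) (hσ₀ : 0 < σ) (hσ₁ : σ < 1)
    (κ : ℝ) (hκ : 0 < κ) :
    ∃ τ : ℝ, 0 < τ ∧
      ∀ (T : DetLDT.Torus d → DetLDT.Torus d) (V : DetLDT.Torus d → ℝ),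
        MeasureTheory.MeasurePreserving T MeasureTheory.volume MeasureTheory.volume →
        DetLDT.PolynomialReturn T →
        DetLDT.UniformlyAnalytic T V →
        ∀ γ : ℝ, 0 < γ → ∀ C : ℝ, 0 < C →
          ∃ N₀ : ℕ, ∀ N : ℕ, N₀ ≤ N → 1 ≤ N → ∀ E : ℝ,
            γ < DetLDT.lyapunov T V E →
            -- large deviation estimate for the monodromy matrix at scale `N`
            MeasureTheory.volume {x : DetLDT.Torus d |
                |DetLDT.logNorm T V E N x - N * DetLDT.finiteLyapunov T V E N|
                  > (N : ℝ) ^ (1 - σ)}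
              ≤ ENNReal.ofReal (C * Real.exp (-(N : ℝ) ^ σ)) →
            -- uniform upper bound at scale `N`
            (⨆ x : DetLDT.Torus d, (1 / (N : ℝ)) * DetLDT.logNorm T V E N x)
              < DetLDT.finiteLyapunov T V E N + (N : ℝ) ^ (-κ) →
            -- the points where the determinant vanishes (logarithm `-∞`) belong to the set
            MeasureTheory.volume {x : DetLDT.Torus d |
                DetLDT.dirichletDet T V E N x = 0 ∨
                  (1 / (N : ℝ)) * Real.log |DetLDT.dirichletDet T V E N x|
                    < DetLDT.finiteLyapunov T V E N - (N : ℝ) ^ (-τ)}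
              ≤ ENNReal.ofReal (Real.exp (-(N : ℝ) ^ τ)) := by
  have hd' : (1 : ℝ) ≤ d := by exact_mod_cast hd
  -- The radius exponent: `θ / 2 < σ, κ` makes the errors in the hypotheses negligible, and `θ d ≤
  -- 1/10` keeps the ball's measure above `N^(-1/10)`. Then `τ = θ / 8` satisfies the condition `6 τ
  -- < θ` of the Remez step.
  set θ : ℝ := min (min σ κ) (1 / (10 * d)) with hθdef
  have hθ : 0 < θ := by positivity
  have hθσ : θ ≤ σ := (min_le_left _ _).trans (min_le_left _ _)
  have hθκ : θ ≤ κ := (min_le_left _ _).trans (min_le_right _ _)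
  have hθd : θ * d ≤ 1 / 10 := by
    have h1 : θ ≤ 1 / (10 * d) := min_le_right _ _
    calc θ * d ≤ 1 / (10 * d) * d := by gcongr
      _ = 1 / 10 := by field_simp
  have hθ10 : θ ≤ 1 / 10 := by nlinarith
  refine ⟨θ / 8, by positivity, ?_⟩
  intro T V hT hret hA γ hγ C hC
  obtain ⟨h, hh, K, hK, hV⟩ := hA.exists_lineExtends
  have hVm : Measurable V := hA.continuous.measurable
  have hVK : ∀ x, |V x| ≤ K := fun x => (hV 0).abs_le hh x
  set B : ℝ := 2 * K + 4 with hB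
  have hev := (((eventually_not_flat (B := B) hd hret hh hK hV hγ).and
    (eventually_flat_of_small (B := B) hh hK hV hT.measurable hVm)).and
    ((eventually_small_on_ball (B := B) (θ := θ) (κ := κ) (τ := θ / 8) hh hK hV hθ (by linarith)
      (by linarith) (by positivity) (by linarith)).and
    (eventually_exists_small_det (B := B) (κ := κ) hT hVm hVK C hθ hθ10 hθd hσ₀ (by linarith)
      (by linarith) hγ))).and
    (((eventually_mul_rpow_le (show 1 - σ < 1 - θ / 8 by linarith) 2).and
      (eventually_le_rpow (show 0 < 1 - θ / 8 by linarith) (2 * Real.log 2))).and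
      (eventually_mul_exp_le (show θ / 8 < σ by linarith) hσ₀ 1 C one_pos))
  obtain ⟨N₀, hN₀⟩ := Filter.eventually_atTop.1 hev
  refine ⟨N₀, fun N hN hN1 E hL hldt hsup => ?_⟩
  obtain ⟨⟨⟨hnotflat, hflat⟩, hball, hdet⟩, ⟨hpow, hlog2⟩, hCexp⟩ := hN₀ N hN
  have hN1' : (1 : ℝ) ≤ N := by exact_mod_cast hN1
  have hN0 : (0 : ℝ) < N := by linarith
  set L := finiteLyapunov T V E N with hLdef
  have hLγ : γ < L := lt_finiteLyapunov hγ hL hN1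
  have hNmul : ∀ a : ℝ, (N : ℝ) * (N : ℝ) ^ (-a) = (N : ℝ) ^ (1 - a) := by
    intro a
    rw [sub_eq_add_neg, Real.rpow_add hN0, Real.rpow_one]
  set S : Set (Torus d) := {x | dirichletDet T V E N x = 0 ∨
    (1 / (N : ℝ)) * Real.log |dirichletDet T V E N x| < L - (N : ℝ) ^ (-(θ / 8))} with hS
  have hgood : ∀ x, ¬ |logNorm T V E N x - N * L| > (N : ℝ) ^ (1 - σ) →
      Real.exp (N * L - (N : ℝ) ^ (1 - σ)) ≤ monodromyNorm T V E N x := by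
    intro x hx
    rw [not_lt, abs_le] at hx
    rw [← Real.le_log_iff_exp_le (monodromyNorm_pos N x), ← logNorm_eq]
    linarith [hx.1]
  -- `N₀` may not depend on `E`. For bounded energies `B` serves uniformly; otherwise `|V - E| ≥ 3`
  -- and the determinant is comparable to the norm.
  by_cases hE : |E| ≤ K + 3
  · have hEB : K + |E| + 1 ≤ B := by rw [hB]; linarith
    have hupper : ∀ x, monodromyNorm T V E N x ≤ Real.exp (N * L + (N : ℝ) ^ (1 - κ)) := by
      intro x
      -- Boundedness is needed for the real supremum in the hypothesis to bound each value.
      have hbdd : BddAbove (Set.range fun x : Torus d => (1 / (N : ℝ)) * logNorm T V E N x) := by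
        refine ⟨(1 / (N : ℝ)) * Real.log (2 * B ^ N), ?_⟩
        rintro _ ⟨z, rfl⟩
        change (1 / (N : ℝ)) * logNorm T V E N z ≤ _
        rw [logNorm_eq]
        gcongr
        · exact monodromyNorm_pos N z
        · exact monodromyNorm_le_two_mul fun i j => abs_monodromy_le hVK hEB N z i j
      have h1 := (le_ciSup hbdd x).trans hsup.le
      rw [one_div, inv_mul_le_iff₀ hN0, mul_add, hNmul, logNorm_eq,
        Real.log_le_iff_le_exp (monodromyNorm_pos N x)] at h1
      exact h1
    by_contra hcon
    have hSm : MeasurableSet S := by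
      have hf : Measurable fun x => dirichletDet T V E N x := by
        simp only [dirichletDet_eq_monodromy]
        exact measurable_monodromy hT.measurable hVm N 0 0
      refine MeasurableSet.union (hf (measurableSet_singleton 0)) ?_
      exact measurableSet_lt ((Real.measurable_log.comp hf.abs).const_mul _) measurable_const
    have hSsmall : ∀ x ∈ S, |monodromy T V E N x 0 0| ≤
        Real.exp (N * L - (N : ℝ) ^ (1 - θ / 8)) := by
      intro x hx
      rw [← dirichletDet_eq_monodromy]
      by_cases h0 : dirichletDet T V E N x = 0
      · rw [h0, abs_zero]; positivity
      · have h1 := (hx.resolve_left h0).le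
        rw [one_div, inv_mul_le_iff₀ hN0, mul_sub, hNmul,
          Real.log_le_iff_le_exp (abs_pos.2 h0)] at h1
        exact h1
    obtain ⟨y, hy⟩ := hball E hEB (N * L) (mul_nonneg hN0.le (by linarith))
      (fun x => (abs_monodromy_le_norm N x 0 0).trans (hupper x)) S hSm hSsmall
      (not_le.1 hcon).le
    obtain ⟨n, hn, hnvol⟩ := hdet E hEB (N * L) (by nlinarith) hupper
      ((MeasureTheory.measure_mono fun x hx => by
        by_contra hx'
        exact absurd (hgood x hx') (not_le.2 hx)).trans hldt) y hy
    exact hnotflat E hEB hL n hn (hflat E hEB n hn hnvol)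
  · have hE3 : ∀ x, 3 ≤ |V x - E| := by
      intro x
      have h1 := abs_sub_abs_le_abs_sub E (V x)
      rw [abs_sub_comm] at h1
      linarith [hVK x, not_le.1 hE]
    have hsub : S ⊆ {x | |logNorm T V E N x - N * L| > (N : ℝ) ^ (1 - σ)} := by
      intro x hx
      by_contra hx'
      have h1 := hgood x hx'
      have h2 := monodromyNorm_le_two_mul (abs_monodromy_le_of_large_energy (T := T) hE3 N x)
      rw [← dirichletDet_eq_monodromy] at h2
      have h3 := h1.trans h2
      have hpos : 0 < |dirichletDet T V E N x| := by
        have := Real.exp_pos (N * L - (N : ℝ) ^ (1 - σ))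
        linarith
      rw [← Real.le_log_iff_exp_le (by positivity), Real.log_mul two_ne_zero hpos.ne'] at h3
      have h4 := hx.resolve_left (abs_pos.1 hpos)
      rw [one_div, inv_mul_lt_iff₀ hN0, mul_sub, hNmul] at h4
      linarith
    refine ((MeasureTheory.measure_mono hsub).trans hldt).trans ?_
    apply ENNReal.ofReal_le_ofReal
    have h1 : Real.exp (1 * (N : ℝ) ^ (θ / 8) - (N : ℝ) ^ σ) =
        Real.exp (-(N : ℝ) ^ σ) / Real.exp (-(N : ℝ) ^ (θ / 8)) := by
      rw [← Real.exp_sub]; ring_nf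
    rw [h1, ← mul_div_assoc, div_le_one (Real.exp_pos _)] at hCexp
    exact hCexp
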